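/- All graphs are finite and simple; all multigraphs are finite and loopless. A subdivision of a multigraph $H$ is a graph obtained from $H$ by replacing each edge $uv$ by a path of length at least one joining $u$ and $v$, these paths being vertex-disjoint except for their ends. A graph $G$ is $J$-subdivision-free if no induced subgraph of $G$ is (isomorphic to) a subdivision of $J$. Let $\chi(G)$ and $\omega(G)$ be the chromatic number and the clique number of $G$, and for an integer $\rho\ge 0$ let $\chi^{\rho}(G)$ be the maximum over all vertices $v$ of the chromatic number of the subgraph of $G$ induced on the set of vertices at distance at most $\rho$ from $v$ (zero for the null graph). An ideal is a class of graphs, closed under isomorphism, that contains every induced subgraph of each of its members. An ideal $\mathcal{C}$ is $\rho$-bounded if there is $\tau$ with $\chi^{\rho}(G)\le\tau$ for all $G\in\mathcal{C}$, and colourable if there is $k$ with $\chi(G)\le k$ for all $G\in\mathcal{C}$. A multigraph $H$ is widespread if for every subdivision $J$ of $H$ and every integer $\kappa\ge 0$ there exists an integer $\rho\ge 0$ such that every $\rho$-bounded ideal of $J$-subdivision-free graphs $G$ with $\omega(G)\le\kappa$ is colourable. To fatten an edge $uv$ means to replace it by a nonempty (finite) set of parallel edges all joining $u$ and $v$. Theorem.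 Let $H$ be a multigraph obtained from the triangle $K_3$ by fattening two of its edges and replacing the third by two parallel edges. Then $H$ is widespread. Moreover, for every subdivision $J$ of $H$, with $n=|V(J)|$, and for all integers $\kappa,\tau\ge 0$, there exists an integer $c\ge 0$ such that $\chi(G)\le c$ for every $J$-subdivision-free graph $G$ with $\chi^{2n+7}(G)\le\tau$ and $\omega(G)\le\kappa$. -/

import Mathlib

universe u w a b

/-- The ends, the paths and the disjointness conditions that exhibit the simple graph `J` as a
subdivision of the multigraph `H`: every edge `e` of `H`, with ends `src e` and `tgt e`, is replaced
by a path of `J` of length at least one, and these paths are vertex-disjoint except for their ends.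
`J` has no other vertices and edges than those that arise in this way. -/
structure SubdivisionModel {α β W : Type*} (H : Graph α β) (J : SimpleGraph W) where
  /-- The vertex of `J` that represents a vertex of `H`. -/
  branch : H.vertexSet → W
  branch_injective : Function.Injective branch
  src : H.edgeSet → H.vertexSet
  tgt : H.edgeSet → H.vertexSet
  isLink : ∀ e : H.edgeSet, H.IsLink e (src e) (tgt e)
  /-- The path that replaces an edge of `H`. -/
  path : ∀ e : H.edgeSet, J.Walk (branch (src e)) (branch (tgt e))
  isPath : ∀ e, (path e).IsPath
  one_le_length : ∀ e, 1 ≤ (path e).length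
  /-- No vertex of `H` is represented in the interior of a path. -/
  eq_end_of_mem : ∀ e v, branch v ∈ (path e).support → v = src e ∨ v = tgt e
  /-- Paths of distinct edges meet in vertices of `H` only. -/
  disjoint : ∀ e f, e ≠ f → ∀ w, w ∈ (path e).support → w ∈ (path f).support →
    w ∈ Set.range branch
  vertex_cover : ∀ w, w ∈ Set.range branch ∨ ∃ e, w ∈ (path e).support
  /-- Every edge of `J` lies in exactly one of the paths. -/
  edge_cover : ∀ d ∈ J.edgeSet, ∃! e, d ∈ (path e).edges

/-- `J` is a subdivision of the multigraph `H`. -/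
def IsSubdivision {α β W : Type*} (H : Graph α β) (J : SimpleGraph W) : Prop :=
  Nonempty (SubdivisionModel H J)

/-- `G` is `J`-subdivision-free: no induced subgraph of `G` is a subdivision of `J`
(the simple graph `J` is regarded as a multigraph here). -/
def SubdivisionFree {W V : Type*} (J : SimpleGraph W) (G : SimpleGraph V) : Prop :=
  ¬ ∃ s : Set V, IsSubdivision (Graph.ofSimpleGraph J) (G.induce s)

/-- The maximum over all vertices `v` of the chromatic number of the subgraph induced on the
vertices at distance at most `ρ` from `v`; zero for the null graph. -/
noncomputable def localChromaticNumber {V : Type*} (ρ : ℕ) (G : SimpleGraph V) : ℕ∞ :=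
  ⨆ v : V, (G.induce {w : V | G.edist v w ≤ (ρ : ℕ∞)}).chromaticNumber

/-- An ideal: a class of finite graphs (closed under isomorphism) that contains, with a graph, all
of its induced subgraphs. -/
structure GraphIdeal where
  Mem : ∀ {V : Type u} [Finite V], SimpleGraph V → Prop
  mem_of_embedding : ∀ {V W : Type u} [Finite V] [Finite W] {G : SimpleGraph V}
    {H : SimpleGraph W}, Nonempty (G ↪g H) → Mem H → Mem G

/-- All members of the ideal have chromatic number at most some constant. -/
def GraphIdeal.Colourable (C : GraphIdeal.{u}) : Prop :=
  ∃ k : ℕ, ∀ (V : Type u) [Finite V] (G : SimpleGraph V), C.Mem G → G.chromaticNumber ≤ (k : ℕ∞)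

/-- The ideal is `ρ`-bounded. -/
def GraphIdeal.Bounded (ρ : ℕ) (C : GraphIdeal.{u}) : Prop :=
  ∃ τ : ℕ, ∀ (V : Type u) [Finite V] (G : SimpleGraph V),
    C.Mem G → localChromaticNumber ρ G ≤ (τ : ℕ∞)

/-- The multigraph `H` is widespread: for every subdivision `J` of `H` and all `κ` there is `ρ` such
that every `ρ`-bounded ideal of `J`-subdivision-free graphs with clique number at most `κ` is
colourable. Here `J` ranges over the graphs in one universe, and the ideals consist of the finite
graphs in another one. -/
def Widespread {α : Type a} {β : Type b} (H : Graph α β) : Prop :=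
  ∀ (W : Type w) [Finite W] (J : SimpleGraph W), IsSubdivision H J → ∀ κ : ℕ, ∃ ρ : ℕ,
    ∀ C : GraphIdeal.{u}, C.Bounded ρ →
      (∀ (V : Type u) [Finite V] (G : SimpleGraph V),
        C.Mem G → SubdivisionFree J G ∧ G.cliqueNum ≤ κ) →
      C.Colourable

/-- The multigraph `H` is obtained (up to isomorphism) from the multigraph `K` by replacing every
edge `e` of `K` by a nonempty finite set of parallel edges with the same ends, namely
by `{f | proj f = e}`. -/
structure Fattening {α β α' β' : Type*} (K : Graph α β) (H : Graph α' β') where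
  vert : H.vertexSet ≃ K.vertexSet
  proj : H.edgeSet → K.edgeSet
  isLink_iff : ∀ (f : H.edgeSet) (x y : H.vertexSet),
    H.IsLink f x y ↔ K.IsLink (proj f) (vert x) (vert y)
  fiber_nonempty : ∀ e, {f | proj f = e}.Nonempty
  fiber_finite : ∀ e, {f | proj f = e}.Finite

/-- `H` is obtained from the triangle `K₃` by fattening two of its edges and replacing the third
one, `e₀`, by two parallel edges. -/
def IsFatTriangle {α β : Type*} (H : Graph α β) : Prop :=
  ∃ (F : Fattening (Graph.ofSimpleGraph (⊤ : SimpleGraph (Fin 3))) H)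
    (e₀ : (Graph.ofSimpleGraph (⊤ : SimpleGraph (Fin 3))).edgeSet),
    {f | F.proj f = e₀}.ncard = 2

/-! Write `n = |V(J)|`, suppose that balls of radius `2n+7` are `τ`-colourable, and let the
chromatic number be huge. Iterated breadth-first search yields a `Tower`: nested sets `C 0 ⊇ … ⊇ C
M` whose top `C M` is still not `4τ`-colourable, pairwise anticomplete connected lines `U i`, and
for every `y` in `C M` a parent `q i y` adjacent to `y` and with a neighbour in `U i`. Pigeonholing
makes it independent of `y` whether `q j y` touches `U i` for `j < i`. By
`exists_star_or_independent` one of two cases occurs.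

Suppose that for many indices, `j`-th parents never touch `U i` when `j < i`. Three far apart
vertices of `C M` serve as branch vertices. A line together with the parents of two of them joins
these two and misses the third. Pigeonholing the colours of the parents makes different parents of
one vertex nonadjacent, so that connections through different lines are anticomplete.

Suppose instead that for some `j` the `j`-th parents touch many later lines. The `j`-th parents of
three far apart vertices serve as branch vertices. Each line joins one of them, a hub, to each of
the other two, with a choice of connections that miss the remaining one; many lines share the same
hub. This supplies the two fattened edges. The two other branch vertices have to be joined exactly
twice: once through `U j` minus the neighbours of the hub, and once through `C M`. The latter route
exists by `hasTriple_of_not_colOn`, the main colouring argument.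

`SubdivisionModel.not_subdivisionFree` turns such centres and connecting sets into an induced
subdivision of `J`: induced paths between centres at distance more than `n` are longer than the
paths of `J` that they have to subdivide. -/

namespace SimpleGraph

/-! ### Connectivity and colouring of vertex subsets. -/

variable {V : Type*} {G : SimpleGraph V}

/-- `G` restricted to the edges with both ends in `S`, as a graph on all of `V`. -/
def within (G : SimpleGraph V) (S : Set V) : SimpleGraph V where
  Adj x y := G.Adj x y ∧ x ∈ S ∧ y ∈ S
  symm := ⟨fun _ _ h => ⟨h.1.symm, h.2.2, h.2.1⟩⟩
  loopless := ⟨fun _ h => G.loopless.irrefl _ h.1⟩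

theorem within_mono {S T : Set V} (h : S ⊆ T) : G.within S ≤ G.within T :=
  fun _ _ hxy => ⟨hxy.1, h hxy.2.1, h hxy.2.2⟩

theorem within_le (S : Set V) : G.within S ≤ G := fun _ _ hxy => hxy.1

/-- The set `S` induces a connected (or empty) subgraph of `G`. -/
def ConnOn (G : SimpleGraph V) (S : Set V) : Prop :=
  ∀ x ∈ S, ∀ y ∈ S, (G.within S).Reachable x y

/-- The vertex `x` has a neighbour in `S`. -/
def Touches (G : SimpleGraph V) (x : V) (S : Set V) : Prop := ∃ y ∈ S, G.Adj x y

theorem Touches.mono {x : V} {S T : Set V} (h : G.Touches x S) (hST : S ⊆ T) :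
    G.Touches x T := by
  obtain ⟨y, hy, hxy⟩ := h
  exact ⟨y, hST hy, hxy⟩

/-- The sets `S` and `T` are disjoint and there are no edges between them. -/
def Anticomplete (G : SimpleGraph V) (S T : Set V) : Prop :=
  ∀ x ∈ S, ∀ y ∈ T, x ≠ y ∧ ¬ G.Adj x y

theorem Anticomplete.symm {S T : Set V} (h : G.Anticomplete S T) : G.Anticomplete T S :=
  fun x hx y hy => ⟨(h y hy x hx).1.symm, fun hxy => (h y hy x hx).2 hxy.symm⟩

theorem Anticomplete.mono {S T S' T' : Set V} (h : G.Anticomplete S T) (hS : S' ⊆ S)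
    (hT : T' ⊆ T) : G.Anticomplete S' T' :=
  fun x hx y hy => h x (hS hx) y (hT hy)

/-- The subgraph of `G` induced on `S` is `k`-colourable. -/
def ColOn (G : SimpleGraph V) (S : Set V) (k : ℕ) : Prop :=
  ∃ f : V → ℕ, (∀ x ∈ S, f x < k) ∧ ∀ x ∈ S, ∀ y ∈ S, G.Adj x y → f x ≠ f y

theorem ColOn.mono {S T : Set V} {k l : ℕ} (h : G.ColOn T l) (hST : S ⊆ T) (hkl : l ≤ k) :
    G.ColOn S k := by
  obtain ⟨f, hf, hp⟩ := h
  exact ⟨f, fun x hx => (hf x (hST hx)).trans_le hkl,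
    fun x hx y hy => hp x (hST hx) y (hST hy)⟩

theorem ColOn.union {S T : Set V} {k l : ℕ} (hS : G.ColOn S k) (hT : G.ColOn T l) :
    G.ColOn (S ∪ T) (k + l) := by
  classical
  obtain ⟨f, hf, hp⟩ := hS
  obtain ⟨g, hg, hq⟩ := hT
  refine ⟨fun x => if x ∈ S then f x else k + g x, ?_, ?_⟩
  · intro x hx
    by_cases h : x ∈ S
    · simp only [h, if_true]; have := hf x h; omega
    · simp only [h, if_false]; have := hg x (hx.resolve_left h); omega
  · intro x hx y hy hxy
    by_cases h : x ∈ S <;> by_cases h' : y ∈ S <;> simp only [h, h', if_true, if_false]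
    · exact hp x h y h' hxy
    · have := hf x h; omega
    · have := hf y h'; omega
    · have := hq x (hx.resolve_left h) y (hy.resolve_left h') hxy; omega

theorem colOn_iff_colorable {S : Set V} {k : ℕ} : G.ColOn S k ↔ (G.induce S).Colorable k := by
  classical
  constructor
  · rintro ⟨f, hf, hp⟩
    exact ⟨Coloring.mk (fun x => (⟨f x, hf x x.2⟩ : Fin k)) fun {x y} hxy h =>
      hp x x.2 y y.2 hxy (congrArg Fin.val h)⟩
  · rintro ⟨C⟩
    refine ⟨fun x => if h : x ∈ S then (C ⟨x, h⟩).val else 0, ?_, ?_⟩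
    · intro x hx; simp only [hx, dite_true]; exact (C ⟨x, hx⟩).isLt
    · intro x hx y hy hxy
      simp only [hx, hy, dite_true]
      intro h
      exact C.valid (v := ⟨x, hx⟩) (w := ⟨y, hy⟩) hxy (Fin.ext h)

/-- The vertices reachable from `x` inside `S`. -/
def compOn (G : SimpleGraph V) (S : Set V) (x : V) : Set V :=
  {y | y ∈ S ∧ (G.within S).Reachable x y}

theorem compOn_subset (S : Set V) (x : V) : G.compOn S x ⊆ S := fun _ h => h.1

theorem mem_compOn_self {S : Set V} {x : V} (h : x ∈ S) : x ∈ G.compOn S x :=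
  ⟨h, Reachable.refl _⟩

theorem compOn_eq {S : Set V} {x y : V} (h : y ∈ G.compOn S x) : G.compOn S y = G.compOn S x := by
  ext z
  exact ⟨fun hz => ⟨hz.1, h.2.trans hz.2⟩, fun hz => ⟨hz.1, h.2.symm.trans hz.2⟩⟩

theorem mem_compOn_of_adj {S : Set V} {x y z : V} (h : y ∈ G.compOn S x) (hz : z ∈ S)
    (hyz : G.Adj y z) : z ∈ G.compOn S x :=
  ⟨hz, h.2.trans (Adj.reachable (G := G.within S) ⟨hyz, h.1, hz⟩)⟩

/-- A walk inside `S` that starts in a subset `T` closed under taking neighbours in `S` stays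
in `T`. -/
theorem reachable_of_closed {S T : Set V} (hT : ∀ y ∈ T, ∀ z ∈ S, G.Adj y z → z ∈ T) {x y : V}
    (hx : x ∈ T) (h : (G.within S).Reachable x y) : y ∈ T ∧ (G.within T).Reachable x y := by
  obtain ⟨p⟩ := h
  induction p with
  | nil => exact ⟨hx, Reachable.refl _⟩
  | cons h p ih =>
    have h2 := hT _ hx _ h.2.2 h.1
    obtain ⟨h3, h4⟩ := ih h2
    exact ⟨h3, (Adj.reachable (G := G.within T) ⟨h.1, hx, h2⟩).trans h4⟩

theorem connOn_compOn (S : Set V) (x : V) : G.ConnOn (G.compOn S x) := by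
  intro y hy z hz
  refine (reachable_of_closed (S := S) (fun a ha b hb hab => mem_compOn_of_adj ha hb hab) hy ?_).2
  exact hy.2.symm.trans hz.2

theorem ConnOn.union_singleton {S : Set V} {x : V} (h : G.ConnOn S) (hx : G.Touches x S) :
    G.ConnOn (insert x S) := by
  obtain ⟨z, hz, hxz⟩ := hx
  have hm := within_mono (G := G) (Set.subset_insert x S)
  have key : ∀ y ∈ insert x S, (G.within (insert x S)).Reachable y z := by
    rintro y (rfl | hy)
    · exact Adj.reachable ⟨hxz, Set.mem_insert _ _, Or.inr hz⟩
    · exact (h y hy z hz).mono hm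
  exact fun a ha b hb => (key a ha).trans (key b hb).symm

/-- A set is `k`-colourable if all its components are. -/
theorem colOn_of_compOn {S : Set V} {k : ℕ} (h : ∀ x ∈ S, G.ColOn (G.compOn S x) k) :
    G.ColOn S k := by
  classical
  -- Colourings are chosen per set, not per vertex, so that all vertices of a component use the same
  -- one.
  choose! F hF hP using fun T : {T : Set V // G.ColOn T k} => T.2
  refine ⟨fun x => if hx : x ∈ S then F ⟨_, h x hx⟩ x else 0, ?_, ?_⟩
  · intro x hx
    simp only [hx, dite_true]
    exact hF ⟨_, h x hx⟩ x (mem_compOn_self hx)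
  · intro x hx y hy hxy
    simp only [hx, hy, dite_true]
    have hy' : y ∈ G.compOn S x := mem_compOn_of_adj (mem_compOn_self hx) hy hxy
    have : (⟨_, h y hy⟩ : {T : Set V // G.ColOn T k}) = ⟨_, h x hx⟩ :=
      Subtype.ext (compOn_eq hy')
    rw [this]
    exact hP ⟨_, h x hx⟩ x (mem_compOn_self hx) y hy' hxy

theorem exists_connOn_not_colOn {S : Set V} {k : ℕ} (h : ¬ G.ColOn S k) :
    ∃ T ⊆ S, G.ConnOn T ∧ ¬ G.ColOn T k := by
  by_contra! hc
  exact h (colOn_of_compOn fun x _ => hc _ (compOn_subset S x) (connOn_compOn S x))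

/-- A set of large chromatic number has a subset of large chromatic number on which each of `M`
predicates is constant. -/
theorem exists_uniform_not_colOn (P : ℕ → V → Prop) (M k : ℕ) {S : Set V}
    (h : ¬ G.ColOn S (2 ^ M * k)) :
    ∃ T ⊆ S, ¬ G.ColOn T k ∧ ∀ j < M, (∀ y ∈ T, P j y) ∨ ∀ y ∈ T, ¬ P j y := by
  induction M generalizing S with
  | zero => exact ⟨S, subset_rfl, by simpa using h, by simp⟩
  | succ M ih =>
    have : ¬ G.ColOn (S ∩ {y | P M y}) (2 ^ M * k) ∨ ¬ G.ColOn (S ∩ {y | ¬ P M y}) (2 ^ M * k) := by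
      by_contra! hc
      refine h ((hc.1.union hc.2).mono (fun x hx => ?_) 
        (by rw [pow_succ, mul_assoc, two_mul, mul_add]))
      by_cases hP : P M x
      · exact Or.inl ⟨hx, hP⟩
      · exact Or.inr ⟨hx, hP⟩
    rcases this with h1 | h1
    · obtain ⟨T, hT, hk, hu⟩ := ih h1
      refine ⟨T, fun x hx => (hT hx).1, hk, fun j hj => ?_⟩
      rcases Nat.lt_succ_iff_lt_or_eq.1 hj with hj | rfl
      · exact hu j hj
      · exact Or.inl fun y hy => (hT hy).2
    · obtain ⟨T, hT, hk, hu⟩ := ih h1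
      refine ⟨T, fun x hx => (hT hx).1, hk, fun j hj => ?_⟩
      rcases Nat.lt_succ_iff_lt_or_eq.1 hj with hj | rfl
      · exact hu j hj
      · exact Or.inr fun y hy => (hT hy).2

theorem mem_support_of_within {S : Set V} {x y z : V} (p : (G.within S).Walk x y) (hx : x ∈ S)
    (hz : z ∈ p.support) : z ∈ S := by
  induction p with
  | nil => simp at hz; rwa [hz]
  | cons h p ih =>
    rw [Walk.support_cons, List.mem_cons] at hz
    rcases hz with rfl | hz
    · exact hx
    · exact ih h.2.2 hz

theorem connOn_support {S : Set V} {x y : V} (p : (G.within S).Walk x y) :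
    G.ConnOn {z | z ∈ p.support} := by
  induction p with
  | nil => intro a ha b hb; simp at ha hb; subst ha; subst hb; exact Reachable.refl _
  | @cons u v w h p ih =>
    have : {z | z ∈ (Walk.cons h p).support} = insert u {z | z ∈ p.support} := by
      ext z; simp
    rw [this]
    exact ih.union_singleton ⟨v, p.start_mem_support, h.1⟩

/-- A walk can be stopped at the first vertex that satisfies a given predicate. -/
theorem exists_walk_first {H : SimpleGraph V} (P : V → Prop) {x y : V} (p : H.Walk x y) (hy : P y) :
    ∃ z, P z ∧ ∃ q : H.Walk x z, ∀ t ∈ q.support, P t → t = z := by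
  induction p with
  | nil => exact ⟨_, hy, Walk.nil, by simp⟩
  | @cons u v w h p ih =>
    by_cases hu : P u
    · exact ⟨u, hu, Walk.nil, by simp⟩
    · obtain ⟨z, hz, q, hq⟩ := ih hy
      refine ⟨z, hz, Walk.cons h q, fun t ht hPt => ?_⟩
      rw [Walk.support_cons, List.mem_cons] at ht
      rcases ht with rfl | ht
      · exact absurd hPt hu
      · exact hq t ht hPt

/-- Inside a connected set touched by `a`, `b` and `c`, no two of which have a common neighbour,
there is a connection from `a` to one of `b`, `c` that is not touched by the other. -/
theorem exists_connection {S : Set V} {a b c : V} (hS : G.ConnOn S) (ha : G.Touches a S)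
    (hb : G.Touches b S) (hbc : ∀ x, G.Adj b x → ¬ G.Adj c x) :
    (∃ T ⊆ S, G.ConnOn T ∧ G.Touches a T ∧ G.Touches b T ∧ ¬ G.Touches c T) ∨
    (∃ T ⊆ S, G.ConnOn T ∧ G.Touches a T ∧ G.Touches c T ∧ ¬ G.Touches b T) := by
  obtain ⟨x, hx, hax⟩ := ha
  obtain ⟨y, hy, hby⟩ := hb
  obtain ⟨p⟩ := hS x hx y hy
  obtain ⟨z, hz, q, hq⟩ := exists_walk_first (fun t => G.Adj b t ∨ G.Adj c t) p (Or.inl hby)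
  have hsub : {t | t ∈ q.support} ⊆ S := fun t ht => mem_support_of_within q hx ht
  rcases hz with hz | hz
  · refine Or.inl ⟨_, hsub, connOn_support q, ⟨x, q.start_mem_support, hax⟩,
      ⟨z, q.end_mem_support, hz⟩, ?_⟩
    rintro ⟨t, ht, hct⟩
    rw [hq t ht (Or.inr hct)] at hct
    exact hbc z hz hct
  · refine Or.inr ⟨_, hsub, connOn_support q, ⟨x, q.start_mem_support, hax⟩,
      ⟨z, q.end_mem_support, hz⟩, ?_⟩
    rintro ⟨t, ht, hct⟩
    rw [hq t ht (Or.inl hct)] at hct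
    exact hbc z hct hz

/-! ### Balls and breadth-first layerings. -/

/-- The set of vertices at distance at most `r` from `x`. -/
def ballOn (G : SimpleGraph V) (x : V) (r : ℕ) : Set V := {y | G.edist x y ≤ (r : ℕ∞)}

theorem mem_ballOn_self (x : V) (r : ℕ) : x ∈ G.ballOn x r := by simp [ballOn]

theorem ballOn_mono (x : V) {r s : ℕ} (h : r ≤ s) : G.ballOn x r ⊆ G.ballOn x s :=
  fun _ hy => le_trans (α := ℕ∞) hy (by exact_mod_cast h)

theorem mem_ballOn_comm {x y : V} {r : ℕ} : y ∈ G.ballOn x r ↔ x ∈ G.ballOn y r := by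
  simp only [ballOn, Set.mem_ofPred_eq, edist_comm]

theorem mem_ballOn_trans {x y z : V} {r s : ℕ} (h : y ∈ G.ballOn x r) (h' : z ∈ G.ballOn y s) :
    z ∈ G.ballOn x (r + s) := by
  simp only [ballOn, Set.mem_ofPred_eq, Nat.cast_add] at *
  exact SimpleGraph.edist_triangle.trans (add_le_add h h')

theorem mem_ballOn_one {x y : V} (h : G.Adj x y) : y ∈ G.ballOn x 1 := by
  simp only [ballOn, Set.mem_ofPred_eq]
  rw [Nat.cast_one, edist_le_one_iff_adj_or_eq]
  exact Or.inl h

theorem mem_ballOn_two {x y z : V} (h : G.Adj x y) (h' : G.Adj y z) : z ∈ G.ballOn x 2 :=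
  mem_ballOn_trans (mem_ballOn_one h) (mem_ballOn_one h')

/-- A piece of a breadth-first layering of `C`: the connected set `U` consists of all but the
last two layers, `Q` is the penultimate layer and `D` is part of the last one. -/
structure IsLayer (G : SimpleGraph V) (C U Q D : Set V) : Prop where
  subset_U : U ⊆ C
  subset_Q : Q ⊆ C
  subset_D : D ⊆ C
  conn : G.ConnOn U
  anti : G.Anticomplete U D
  disjoint_QD : Disjoint Q D
  disjoint_UQ : Disjoint U Q
  parent : ∀ d ∈ D, ∃ q ∈ Q, G.Adj d q
  touch : ∀ q ∈ Q, G.Touches q U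
  conn_diff : ∀ q ∈ Q, G.ConnOn (U \ {x | G.Adj q x})

theorem IsLayer.mono {C U Q D D' : Set V} (h : G.IsLayer C U Q D) (hD : D' ⊆ D) :
    G.IsLayer C U Q D' where
  subset_U := h.subset_U
  subset_Q := h.subset_Q
  subset_D := hD.trans h.subset_D
  conn := h.conn
  anti := h.anti.mono subset_rfl hD
  disjoint_QD := h.disjoint_QD.mono_right hD
  disjoint_UQ := h.disjoint_UQ
  parent := fun d hd => h.parent d (hD hd)
  touch := h.touch
  conn_diff := h.conn_diff

/-- A set on which distance from `r` can always be decreased is connected. -/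
theorem connOn_of_descent {S : Set V} {r : V} (lev : V → ℕ)
    (h : ∀ x ∈ S, x = r ∨ ∃ y ∈ S, G.Adj x y ∧ lev y < lev x) : G.ConnOn S := by
  have key : ∀ n, ∀ x ∈ S, lev x = n → (G.within S).Reachable x r := by
    intro n
    induction n using Nat.strong_induction_on with
    | _ n ih =>
      intro x hx hn
      rcases h x hx with rfl | ⟨y, hy, hxy, hl⟩
      · exact Reachable.refl _
      · exact (Adj.reachable (G := G.within S) ⟨hxy, hx, hy⟩).trans
          (ih _ (hn ▸ hl) y hy rfl)
  exact fun x hx y hy => (key _ x hx rfl).trans (key _ y hy rfl).symm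

/-- Layer `C` by distance from a root, measured inside `C`. Levels up to 2 lie in a ball and cost
`τ` colours. Edges join equal or consecutive levels, so if all later levels were `k`-colourable, `k`
colours for each parity would suffice for them. -/
theorem exists_layer {C : Set V} {τ k : ℕ} (hC : G.ConnOn C) (hball : ∀ x, G.ColOn (G.ballOn x 2) τ)
    (hcol : ¬ G.ColOn C (τ + 2 * k)) : ∃ U Q D, G.IsLayer C U Q D ∧ ¬ G.ColOn D k := by
  classical
  obtain ⟨r, hr⟩ : C.Nonempty := by
    rw [Set.nonempty_iff_ne_empty]
    rintro rfl
    exact hcol ⟨fun _ => 0, by simp, by simp⟩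
  set lev : V → ℕ := fun v => (G.within C).dist r v with hlev
  have hrr : lev r = 0 := by simp [hlev]
  have hadj : ∀ x ∈ C, ∀ y ∈ C, G.Adj x y → lev y ≤ lev x + 1 := by
    intro x hx y hy hxy
    obtain ⟨p, hp⟩ := (hC r hr x hx).exists_walk_length_eq_dist
    have hw : (G.within C).Adj x y := ⟨hxy, hx, hy⟩
    have := dist_le (p.append (Walk.cons hw Walk.nil))
    rwa [Walk.length_append, hp, Walk.length_cons, Walk.length_nil] at this
  have hpar : ∀ x ∈ C, x = r ∨ ∃ y ∈ C, G.Adj x y ∧ lev y + 1 = lev x := by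
    intro x hx
    obtain ⟨p, hp⟩ := (hC x hx r hr).exists_walk_length_eq_dist
    cases p with
    | nil => exact Or.inl rfl
    | @cons _ y _ h p =>
      refine Or.inr ⟨y, h.2.2, h.1, ?_⟩
      have h1 : lev y ≤ p.length := by
        simp only [hlev]; rw [dist_comm]; exact dist_le p
      have h2 : lev x = p.length + 1 := by
        simp only [hlev]; rw [dist_comm, ← hp]; simp
      have h3 := hadj y h.2.2 x hx h.1.symm
      omega
  have hlow : {x | x ∈ C ∧ lev x ≤ 2} ⊆ G.ballOn r 2 := by
    rintro x ⟨hx, hl⟩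
    obtain ⟨p, hp⟩ := (hC r hr x hx).exists_walk_length_eq_dist
    have h1 := edist_le (p.mapLe (within_le C))
    simp only [ballOn, Set.mem_ofPred_eq]
    refine h1.trans ?_
    simp only [Walk.length_map, hp]
    exact_mod_cast hl
  obtain ⟨i, hi, hD⟩ : ∃ i, 3 ≤ i ∧ ¬ G.ColOn {x | x ∈ C ∧ lev x = i} k := by
    by_contra! hc
    choose! F hF hP using hc
    apply hcol
    have h1 : G.ColOn {x | x ∈ C ∧ 3 ≤ lev x} (2 * k) := by
      refine ⟨fun x => F (lev x) x + if Even (lev x) then 0 else k, ?_, ?_⟩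
      · rintro x ⟨hx, hl⟩
        have := hF _ hl x ⟨hx, rfl⟩
        dsimp only
        split_ifs <;> omega
      · rintro x ⟨hx, hlx⟩ y ⟨hy, hly⟩ hxy h
        have e1 := hadj x hx y hy hxy
        have e2 := hadj y hy x hx hxy.symm
        have f1 := hF _ hlx x ⟨hx, rfl⟩
        have f2 := hF _ hly y ⟨hy, rfl⟩
        by_cases e : lev x = lev y
        · dsimp only at h
          rw [e] at h
          exact hP _ hly x ⟨hx, e⟩ y ⟨hy, rfl⟩ hxy (by omega)
        · have : lev x = lev y + 1 ∨ lev y = lev x + 1 := by omega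
          dsimp only at h
          rcases this with e | e
          · rw [e] at h f1
            by_cases hev : Even (lev y)
            · simp only [hev, Nat.even_add_one, not_true, if_true, if_false] at h; omega
            · simp only [hev, Nat.even_add_one, not_false_eq_true, if_true, if_false] at h; omega
          · rw [e] at h f2
            by_cases hev : Even (lev x)
            · simp only [hev, Nat.even_add_one, not_true, if_true, if_false] at h; omega
            · simp only [hev, Nat.even_add_one, not_false_eq_true, if_true, if_false] at h; omega
    refine (((hball r).mono hlow le_rfl).union h1).mono (fun x hx => ?_) le_rfl
    by_cases h : lev x ≤ 2
    · exact Or.inl ⟨hx, h⟩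
    · exact Or.inr ⟨hx, by omega⟩
  refine ⟨{x | x ∈ C ∧ lev x + 2 ≤ i}, {x | x ∈ C ∧ lev x + 1 = i}, _, ?_, hD⟩
  refine ⟨fun x h => h.1, fun x h => h.1, fun x h => h.1, ?_, ?_, ?_, ?_, ?_, ?_, ?_⟩
  · refine connOn_of_descent (r := r) lev ?_
    rintro x ⟨hx, hl⟩
    rcases hpar x hx with h | ⟨y, hy, hxy, h⟩
    · exact Or.inl h
    · exact Or.inr ⟨y, ⟨hy, by omega⟩, hxy, by omega⟩
  · rintro x ⟨hx, hl⟩ y ⟨hy, hl'⟩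
    refine ⟨?_, fun hxy => ?_⟩
    · rintro rfl; omega
    · have := hadj x hx y hy hxy; omega
  · rw [Set.disjoint_left]
    rintro x ⟨hx, hl⟩ ⟨_, hl'⟩; omega
  · rw [Set.disjoint_left]
    rintro x ⟨hx, hl⟩ ⟨_, hl'⟩; omega
  · rintro x ⟨hx, hl⟩
    rcases hpar x hx with rfl | ⟨y, hy, hxy, h⟩
    · omega
    · exact ⟨y, ⟨hy, by omega⟩, hxy⟩
  · rintro x ⟨hx, hl⟩
    rcases hpar x hx with rfl | ⟨y, hy, hxy, h⟩
    · omega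
    · exact ⟨y, ⟨hy, by omega⟩, hxy⟩
  · rintro q ⟨hq, hlq⟩
    -- The neighbours of `q` in `U` are all in the deepest level `i - 2` of `U`; a descent enters
    -- only levels up to `i - 3` and so avoids them.
    refine connOn_of_descent (r := r) lev ?_
    rintro x ⟨⟨hx, hl⟩, hqx⟩
    rcases hpar x hx with h | ⟨y, hy, hxy, h⟩
    · exact Or.inl h
    · refine Or.inr ⟨y, ⟨⟨hy, by omega⟩, fun hqy => ?_⟩, hxy, by omega⟩
      have := hadj y hy q hq (G.adj_symm hqy); omega

/-! ### Towers of nested layerings. -/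

/-- Nested layerings: `C 0 ⊇ C 1 ⊇ … ⊇ C M`, where each `C (i + 1)` is part of the last layer of a
layering of `C i`, with chosen parents `q i y`, and such that whether the `j`-th parents touch the
`i`-th line `U i` does not depend on the vertex. -/
structure Tower (G : SimpleGraph V) (M : ℕ) (C U Q : ℕ → Set V) (q : ℕ → V → V) : Prop where
  layer : ∀ i < M, G.IsLayer (C i) (U i) (Q i) (C (i + 1))
  parent : ∀ i < M, ∀ y ∈ C (i + 1), q i y ∈ Q i ∧ G.Adj y (q i y)
  uniform : ∀ i < M, ∀ j < i,
    (∀ y ∈ C (i + 1), G.Touches (q j y) (U i)) ∨ ∀ y ∈ C (i + 1), ¬ G.Touches (q j y) (U i)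
  conn : G.ConnOn (C M)

/-- The chromatic number needed to build a tower of height `M` with a top that is not
`k`-colourable. -/
def towerBound (τ : ℕ) : ℕ → ℕ → ℕ
  | 0, k => k
  | M + 1, k => towerBound τ M (τ + 2 * (2 ^ M * k))

/-- One more storey costs `τ + 2 * _` for the new layering and a factor `2 ^ M` for making the `M`
predicates "the `j`-th parent touches the new line" constant. Passing to a component keeps the top
connected. -/
theorem exists_tower {τ : ℕ} (hball : ∀ x, G.ColOn (G.ballOn x 2) τ) (M k : ℕ) {S : Set V}
    (hS : ¬ G.ColOn S (towerBound τ M k)) :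
    ∃ C U Q q, G.Tower M C U Q q ∧ ¬ G.ColOn (C M) k := by
  classical
  induction M generalizing k with
  | zero =>
    obtain ⟨T, -, hT, hk⟩ := exists_connOn_not_colOn hS
    exact ⟨fun _ => T, fun _ => ∅, fun _ => ∅, fun _ => id,
      ⟨by simp, by simp, by simp, hT⟩, hk⟩
  | succ M ih =>
    obtain ⟨C, U, Q, q, hT, hk⟩ := ih _ hS
    obtain ⟨U', Q', D, hL, hD⟩ := exists_layer hT.conn hball hk
    obtain ⟨D', hD', hk', hu⟩ :=
      exists_uniform_not_colOn (fun j y => G.Touches (q j y) U') M k hD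
    obtain ⟨T, hTD, hTc, hTk⟩ := exists_connOn_not_colOn hk'
    have hLT := hL.mono (hTD.trans hD')
    choose! q' hq' hadj using hLT.parent
    refine ⟨Function.update C (M + 1) T, Function.update U M U', Function.update Q M Q',
      Function.update q M q', ⟨?_, ?_, ?_, ?_⟩, ?_⟩
    · intro i hi
      rcases Nat.lt_succ_iff_lt_or_eq.1 hi with hi | rfl
      · rw [Function.update_of_ne (by omega), Function.update_of_ne (by omega),
          Function.update_of_ne (by omega), Function.update_of_ne (by omega)]
        exact hT.layer i hi
      · rw [Function.update_of_ne (by omega)]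
        simpa using hLT
    · intro i hi
      rcases Nat.lt_succ_iff_lt_or_eq.1 hi with hi | rfl
      · rw [Function.update_of_ne (by omega), Function.update_of_ne (by omega),
          Function.update_of_ne (by omega)]
        exact hT.parent i hi
      · simpa using fun y hy => ⟨hq' y hy, hadj y hy⟩
    · intro i hi j hj
      rcases Nat.lt_succ_iff_lt_or_eq.1 hi with hi | rfl
      · rw [Function.update_of_ne (by omega), Function.update_of_ne (by omega),
          Function.update_of_ne (by omega)]
        exact hT.uniform i hi j hj
      · rw [Function.update_of_ne (by omega : j ≠ i)]
        simp only [Function.update_self]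
        exact (hu j hj).imp (fun h y hy => h y (hTD hy)) fun h y hy => h y (hTD hy)
    · simpa using hTc
    · simpa using hTk

namespace Tower

variable {M : ℕ} {C U Q : ℕ → Set V} {q : ℕ → V → V}

theorem antitone (h : G.Tower M C U Q q) {i j : ℕ} (hij : i ≤ j) (hj : j ≤ M) : C j ⊆ C i := by
  induction j, hij using Nat.le_induction with
  | base => exact subset_rfl
  | succ j hij ih => exact (h.layer j (by omega)).subset_D.trans (ih (by omega))

theorem U_anti (h : G.Tower M C U Q q) {i j : ℕ} (hij : i < j) (hj : j ≤ M) :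
    G.Anticomplete (U i) (C j) :=
  (h.layer i (by omega)).anti.mono subset_rfl (h.antitone hij hj)

theorem U_anti_U (h : G.Tower M C U Q q) {i j : ℕ} (hi : i < M) (hj : j < M) (hij : i ≠ j) :
    G.Anticomplete (U i) (U j) := by
  rcases lt_or_gt_of_ne hij with hij | hij
  · exact (h.U_anti hij hj.le).mono subset_rfl (h.layer j hj).subset_U
  · exact ((h.U_anti hij hi.le).mono subset_rfl (h.layer i hi).subset_U).symm

theorem Q_disjoint (h : G.Tower M C U Q q) {i j : ℕ} (hij : i < j) (hj : j ≤ M) :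
    Disjoint (Q i) (C j) :=
  (h.layer i (by omega)).disjoint_QD.mono_right (h.antitone hij hj)

theorem parent_top (h : G.Tower M C U Q q) {i : ℕ} (hi : i < M) {y : V} (hy : y ∈ C M) :
    q i y ∈ Q i ∧ G.Adj y (q i y) :=
  h.parent i hi y (h.antitone hi le_rfl hy)

end Tower

/-! ### A Ramsey-type dichotomy for indices. -/

/-- Either some index is related to many later ones, or there are many pairwise unrelated
indices. -/
theorem exists_star_or_independent (t : ℕ → ℕ → Prop) (N m : ℕ) (I : Finset ℕ)
    (hI : m * (N + 1) ≤ I.card) :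
    (∃ j ∈ I, ∃ F ⊆ I, N ≤ F.card ∧ ∀ i ∈ F, j < i ∧ t j i) ∨
    ∃ F ⊆ I, F.card = m ∧ ∀ j ∈ F, ∀ i ∈ F, j < i → ¬ t j i := by
  classical
  induction m generalizing I with
  | zero => exact Or.inr ⟨∅, by simp, rfl, by simp⟩
  | succ m ih =>
    have hne : I.Nonempty := Finset.card_pos.1 (by rw [add_mul] at hI; omega)
    -- Greedy choice: if the least index is related to fewer than `N` others, then keeping it and
    -- discarding those loses at most `N` indices.
    set j := I.min' hne
    have hj : j ∈ I := I.min'_mem hne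
    by_cases hF : N ≤ ((I.erase j).filter fun i => t j i).card
    · refine Or.inl ⟨j, hj, _, (Finset.filter_subset _ _).trans (Finset.erase_subset _ _), hF,
        fun i hi => ?_⟩
      rw [Finset.mem_filter, Finset.mem_erase] at hi
      exact ⟨lt_of_le_of_ne (I.min'_le i hi.1.2) hi.1.1.symm, hi.2⟩
    · have hc : m * (N + 1) ≤ ((I.erase j).filter fun i => ¬ t j i).card := by
        have h1 := Finset.card_filter_add_card_filter_not (s := I.erase j) (fun i => t j i)
        rw [Finset.card_erase_of_mem hj] at h1
        rw [add_mul] at hI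
        omega
      have hsub : ((I.erase j).filter fun i => ¬ t j i) ⊆ I :=
        (Finset.filter_subset _ _).trans (Finset.erase_subset _ _)
      rcases ih _ hc with ⟨j', hj', F, hF, h⟩ | ⟨F, hF, hcard, h⟩
      · exact Or.inl ⟨j', hsub hj', F, hF.trans hsub, h⟩
      · have hjF : j ∉ F := fun h => by simpa using hF h
        refine Or.inr ⟨insert j F, Finset.insert_subset hj (hF.trans hsub), ?_, ?_⟩
        · rw [Finset.card_insert_of_notMem hjF, hcard]
        · intro a ha b hb hab
          rw [Finset.mem_insert] at ha hb
          rcases ha with rfl | ha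
          · rcases hb with rfl | hb
            · omega
            · exact (Finset.mem_filter.1 (hF hb)).2
          · rcases hb with rfl | hb
            · exact absurd (I.min'_le a (hsub (hF ha))) (not_le.2 hab)
            · exact h a ha b hb hab

/-! ### Three far apart vertices whose images under `p` are well connected. -/

/-- `C` has a proper colouring with `2 * τ` colours from each of two palettes, such that
the members of `C` with a neighbour in `S` use the first palette. -/
def PaletteCol (G : SimpleGraph V) (τ : ℕ) (C S : Set V) : Prop :=
  ∃ (g : V → Bool) (f : V → ℕ), (∀ x ∈ C, f x < 2 * τ) ∧
    (∀ x ∈ C, ∀ y ∈ C, G.Adj x y → g x = g y → f x ≠ f y) ∧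
    ∀ x ∈ C, G.Touches x S → g x = true

theorem paletteCol_of_compOn {τ : ℕ} {C S : Set V}
    (h : ∀ x ∈ C, G.PaletteCol τ (G.compOn C x) S) : G.PaletteCol τ C S := by
  classical
  choose! g f hf hP hS using fun T : {T : Set V // G.PaletteCol τ T S} => T.2
  have key : ∀ x (hx : x ∈ C) y (hy : y ∈ C), G.Adj x y →
      (⟨_, h y hy⟩ : {T : Set V // G.PaletteCol τ T S}) = ⟨_, h x hx⟩ := fun x hx y hy hxy =>
    Subtype.ext (compOn_eq (mem_compOn_of_adj (mem_compOn_self hx) hy hxy))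
  refine ⟨fun x => if hx : x ∈ C then g ⟨_, h x hx⟩ x else true,
    fun x => if hx : x ∈ C then f ⟨_, h x hx⟩ x else 0, ?_, ?_, ?_⟩
  · intro x hx
    simp only [hx, dite_true]
    exact hf ⟨_, h x hx⟩ x (mem_compOn_self hx)
  · intro x hx y hy hxy
    simp only [hx, hy, dite_true]
    rw [key x hx y hy hxy]
    exact hP ⟨_, h x hx⟩ x (mem_compOn_self hx) y
      (mem_compOn_of_adj (mem_compOn_self hx) hy hxy) hxy
  · intro x hx hxS
    simp only [hx, dite_true]
    exact hS ⟨_, h x hx⟩ x (mem_compOn_self hx) hxS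

/-- Three vertices of `K`, pairwise at distance more than `ρ`, such that any two of their images
under `p` are connected through `K` by a set not touched by the third. -/
def HasTriple (G : SimpleGraph V) (K : Set V) (p : V → V) (ρ : ℕ) : Prop :=
  ∃ a ∈ K, ∃ b ∈ K, ∃ c ∈ K, b ∉ G.ballOn a ρ ∧ c ∉ G.ballOn a ρ ∧ c ∉ G.ballOn b ρ ∧
    (∃ S ⊆ K, G.ConnOn S ∧ G.Touches (p a) S ∧ G.Touches (p b) S ∧ ¬ G.Touches (p c) S) ∧
    (∃ S ⊆ K, G.ConnOn S ∧ G.Touches (p a) S ∧ G.Touches (p c) S ∧ ¬ G.Touches (p b) S) ∧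
    ∃ S ⊆ K, G.ConnOn S ∧ G.Touches (p b) S ∧ G.Touches (p c) S ∧ ¬ G.Touches (p a) S

section

variable {K : Set V} {p : V → V} {ρ : ℕ}

/-- The part of `C` off the neighbourhood of `p y` that is connected to a neighbour of `S`. -/
def reachPart (G : SimpleGraph V) (C S : Set V) (v : V) : Set V :=
  {x | ∃ r ∈ C, G.Touches r S ∧ ¬ G.Adj v r ∧ x ∈ G.compOn (C \ {z | G.Adj v z}) r}

theorem reachPart_subset {C S : Set V} {v : V} : G.reachPart C S v ⊆ C \ {z | G.Adj v z} := by
  rintro x ⟨r, -, -, -, hx⟩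
  exact hx.1

theorem mem_reachPart_of_adj {C S : Set V} {v x y : V} (hx : x ∈ G.reachPart C S v) (hy : y ∈ C)
    (hvy : ¬ G.Adj v y) (hxy : G.Adj x y) : y ∈ G.reachPart C S v := by
  obtain ⟨r, hr, hrS, hvr, hx⟩ := hx
  exact ⟨r, hr, hrS, hvr, mem_compOn_of_adj hx ⟨hy, hvy⟩ hxy⟩

/-- If the neighbours of `w` avoid the part reached off the neighbours of `v`, then this part is
also reached off the neighbours of `w`. -/
theorem reachPart_mono {C S : Set V} {v w : V} (h : ∀ x ∈ G.reachPart C S v, ¬ G.Adj w x) :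
    G.reachPart C S v ⊆ G.reachPart C S w := by
  rintro x ⟨r, hr, hrS, hvr, hx⟩
  have hsub : G.compOn (C \ {z | G.Adj v z}) r ⊆ C \ {z | G.Adj w z} := fun y hy =>
    ⟨hy.1.1, h y ⟨r, hr, hrS, hvr, hy⟩⟩
  refine ⟨r, hr, hrS, (hsub (mem_compOn_self ⟨hr, hvr⟩)).2, hsub hx, ?_⟩
  exact (connOn_compOn (C \ {z | G.Adj v z}) r r (mem_compOn_self ⟨hr, hvr⟩) x hx).mono (within_mono hsub)

/-- If a neighbour of `p y` lies in the part reached off the neighbours of `p x`, then `p a` and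
`p y` are connected by a set not touched by `p x`. -/
theorem exists_connection_of_mem_reachPart {C : Set V} {a x y v : V} (hC : C ⊆ K)
    (hv : v ∈ G.reachPart C {z | z ∈ K ∧ G.Adj (p a) z} (p x)) (hvy : G.Adj (p y) v)
    (hax : ∀ z, G.Adj (p a) z → ¬ G.Adj (p x) z) :
    ∃ S ⊆ K, G.ConnOn S ∧ G.Touches (p a) S ∧ G.Touches (p y) S ∧ ¬ G.Touches (p x) S := by
  obtain ⟨r, hr, ⟨n, ⟨hnK, hn⟩, hrn⟩, hvr, hv⟩ := hv
  refine ⟨insert n (G.compOn (C \ {z | G.Adj (p x) z}) r), ?_, ?_, ⟨n, Set.mem_insert _ _, hn⟩,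
    ⟨v, Or.inr hv, hvy⟩, ?_⟩
  · rintro z (rfl | hz)
    · exact hnK
    · exact hC hz.1.1
  · exact (connOn_compOn _ _).union_singleton ⟨r, mem_compOn_self ⟨hr, hvr⟩, hrn.symm⟩
  · rintro ⟨z, rfl | hz, hxz⟩
    · exact hax _ hn hxz
    · exact hz.1.2 hxz

/-- Induction on `|C|`. For a suitable `y` far from `a`, the part of `C` reached from `N(p a)` off
`N(p y)`, together with `N(p y)`, lies in two balls and takes the first palette. The rest is
coloured by induction with `y` in place of `a`. The demand on neighbours of `N(p y)` there is what
makes the two colourings fit once the palettes are swapped. -/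
theorem paletteCol_of_not_hasTriple [Finite V] {τ : ℕ} (hρ : 4 ≤ ρ)
    (hball : ∀ x, G.ColOn (G.ballOn x ρ) τ) (hp : ∀ y ∈ K, G.Adj y (p y))
    (hK : ¬ G.HasTriple K p ρ) (n : ℕ) (C : Set V) (hn : C.ncard = n) (hCK : C ⊆ K) (a : V)
    (ha : a ∈ K) (hCa : ∀ x ∈ C, ¬ G.Adj (p a) x) :
    G.PaletteCol τ C {z | z ∈ K ∧ G.Adj (p a) z} := by
  classical
  induction n using Nat.strong_induction_on generalizing C a with
  | _ n ih =>
  have hfar : ∀ x ∈ K, ∀ y ∈ K, y ∉ G.ballOn x ρ → ∀ z, G.Adj (p x) z → ¬ G.Adj (p y) z := by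
    intro x hx y hy hxy z h1 h2
    exact hxy (ballOn_mono x hρ (mem_ballOn_trans (r := 2) (s := 2)
      (mem_ballOn_two (hp x hx) h1) (mem_ballOn_two h2.symm (hp y hy).symm)))
  by_cases hconn : G.ConnOn C
  swap
  · refine paletteCol_of_compOn fun x hx => ?_
    have hlt : (G.compOn C x).ncard < n := by
      rw [← hn]
      refine Set.ncard_lt_ncard (Set.ssubset_iff_subset_ne.2 ⟨compOn_subset C x, fun h => ?_⟩)
      exact hconn (h ▸ connOn_compOn C x)
    exact ih _ hlt _ rfl ((compOn_subset C x).trans hCK) a ha fun y hy => hCa y hy.1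
  by_cases hall : ∀ y ∈ C, y ∈ G.ballOn a ρ
  · obtain ⟨f, hf, hfp⟩ := hball a
    exact ⟨fun _ => true, f, fun x hx => by have := hf x (hall x hx); omega,
      fun x hx y hy hxy _ => hfp x (hall x hx) y (hall y hy) hxy, fun _ _ _ => rfl⟩
  push Not at hall
  set S := {z | z ∈ K ∧ G.Adj (p a) z} with hS
  -- Minimality makes `p x` miss the reached part of `y` for every `x` far from `a` and `y`. If `p
  -- x` and `p y` each touch the other's reached part, then `a`, `y`, `x` form a triple, with `C`
  -- itself joining `p y` to `p x`. If `p y` misses the part of `x`, that part is contained in the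
  -- one of `y`, hence equal to it.
  obtain ⟨y, ⟨hyC, hya⟩, hmin⟩ := Set.exists_min_image {y | y ∈ C ∧ y ∉ G.ballOn a ρ}
    (fun y => (G.reachPart C S (p y)).ncard) (Set.toFinite _) hall
  have hyK := hCK hyC
  have hblock : ∀ x ∈ C, x ∉ G.ballOn a ρ → x ∉ G.ballOn y ρ →
      ∀ v ∈ G.reachPart C S (p y), ¬ G.Adj (p x) v := by
    intro x hx hxa hxy
    have hxK := hCK hx
    by_cases h1 : ∃ v ∈ G.reachPart C S (p y), G.Adj (p x) v
    · by_cases h2 : ∃ v ∈ G.reachPart C S (p x), G.Adj (p y) v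
      · exfalso
        obtain ⟨v1, hv1, hv1x⟩ := h1
        obtain ⟨v2, hv2, hv2y⟩ := h2
        refine hK ⟨a, ha, y, hyK, x, hxK, hya, hxa, hxy,
          exists_connection_of_mem_reachPart hCK hv2 hv2y (hfar a ha x hxK hxa),
          exists_connection_of_mem_reachPart hCK hv1 hv1x (hfar a ha y hyK hya),
          C, hCK, hconn, ⟨y, hyC, (hp y hyK).symm⟩, ⟨x, hx, (hp x hxK).symm⟩, ?_⟩
        rintro ⟨z, hz, hza⟩
        exact hCa z hz hza
      · push Not at h2
        have heq := Set.eq_of_subset_of_ncard_le (reachPart_mono h2) (hmin x ⟨hx, hxa⟩)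
        rw [← heq]
        exact fun v hv => (reachPart_subset hv).2
    · push Not at h1
      exact h1
  set T : Set V := {z | z ∈ C ∧ G.Adj (p y) z} with hT
  set L := G.reachPart C S (p y) with hL
  have hLsub : L ⊆ C := fun x hx => (reachPart_subset hx).1
  -- A vertex `x` of `L` is itself a neighbour of `p x`, so it cannot be far from both `a` and `y`.
  have hbag : G.ColOn (L ∪ T) (2 * τ) := by
    refine ((hball y).union (hball a)).mono (fun x hx => ?_) (by omega)
    by_contra hc
    rw [Set.mem_union, not_or] at hc
    rcases hx with hx | hx
    · exact hblock x (hLsub hx) hc.2 hc.1 x hx (hp x (hCK (hLsub hx))).symm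
    · exact hc.1 (ballOn_mono y (by omega : 2 ≤ ρ) (mem_ballOn_two (hp y hyK) hx.2))
  have hlt : (C \ (L ∪ T)).ncard < n := by
    rw [← hn]
    refine Set.ncard_lt_ncard (Set.ssubset_iff_subset_ne.2 ⟨Set.sdiff_subset, fun h => ?_⟩)
    rw [← h] at hyC
    exact hyC.2 (Or.inr ⟨hyC.1, (hp y hyK).symm⟩)
  obtain ⟨g, f, hf, hfp, hg⟩ := ih _ hlt _ rfl (Set.sdiff_subset.trans hCK) y hyK
    fun x hx h => hx.2 (Or.inr ⟨hx.1, h⟩)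
  obtain ⟨e, he, hep⟩ := hbag
  -- A neighbour of `L` in `C` lies in `L` or `T`, so edges leaving `L ∪ T` start in `T`, and their
  -- other ends touch `N(p y)`.
  have hcross : ∀ x ∈ C, ∀ z ∈ C, x ∈ L ∪ T → z ∉ L ∪ T → G.Adj x z → g z = true := by
    intro x hx z hz hxb hzb hxz
    refine hg z ⟨hz, hzb⟩ ⟨x, ⟨hCK hx, ?_⟩, hxz.symm⟩
    rcases hxb with hxb | hxb
    · exfalso
      by_cases hyz : G.Adj (p y) z
      · exact hzb (Or.inr ⟨hz, hyz⟩)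
      · exact hzb (Or.inl (mem_reachPart_of_adj hxb hz hyz hxz))
    · exact hxb.2
  -- The negation swaps the palettes: outside neighbours of `T` move to the second one, while `L ∪
  -- T`, which contains all vertices of `C` touching `S`, has the first.
  refine ⟨fun x => if x ∈ L ∪ T then true else !(g x), fun x => if x ∈ L ∪ T then e x else f x,
    ?_, ?_, ?_⟩
  · intro x hx
    by_cases h : x ∈ L ∪ T
    · simp only [h, if_true]; exact he x h
    · simp only [h, if_false]; exact hf x ⟨hx, h⟩
  · intro x hx z hz hxz
    by_cases h : x ∈ L ∪ T <;> by_cases h' : z ∈ L ∪ T <;> simp only [h, h', if_true, if_false]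
    · exact fun _ => hep x h z h' hxz
    · intro hg'
      simp [hcross x hx z hz h h' hxz] at hg'
    · intro hg'
      simp [hcross z hz x hx h' h hxz.symm] at hg'
    · intro hg'
      exact hfp x ⟨hx, h⟩ z ⟨hz, h'⟩ hxz (Bool.not_inj hg')
  · intro x hx hxS
    have : x ∈ L ∪ T := by
      by_cases hyx : G.Adj (p y) x
      · exact Or.inr ⟨hx, hyx⟩
      · exact Or.inl ⟨x, hx, hxS, hyx, mem_compOn_self ⟨hx, hyx⟩⟩
    simp [this]

/-- Without a triple, `K` minus `N(p a)` has a palette colouring. The neighbours of `p a` lie in a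
ball and reuse the low colours; their neighbours elsewhere are in the first palette, which is
shifted up by `2 * τ`. -/
theorem hasTriple_of_not_colOn [Finite V] {τ : ℕ} (hρ : 4 ≤ ρ)
    (hball : ∀ x, G.ColOn (G.ballOn x ρ) τ) (hp : ∀ y ∈ K, G.Adj y (p y))
    (hK : ¬ G.ColOn K (4 * τ)) : G.HasTriple K p ρ := by
  classical
  by_contra hc
  obtain ⟨a, ha⟩ : K.Nonempty := by
    rw [Set.nonempty_iff_ne_empty]
    rintro rfl
    exact hK ⟨fun _ => 0, by simp, by simp⟩
  obtain ⟨g, f, hf, hfp, hg⟩ := paletteCol_of_not_hasTriple hρ hball hp hc _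
    (K \ {z | G.Adj (p a) z}) rfl Set.sdiff_subset a ha fun x hx => hx.2
  obtain ⟨e, he, hep⟩ := hball a
  have hb : ∀ x, G.Adj (p a) x → x ∈ G.ballOn a ρ := fun x hx =>
    ballOn_mono a (by omega : 2 ≤ ρ) (mem_ballOn_two (hp a ha) hx)
  refine hK ⟨fun x => if G.Adj (p a) x then e x else if g x then 2 * τ + f x else f x,
    ?_, ?_⟩
  · intro x hx
    dsimp only
    split_ifs with h1 h2
    · have := he x (hb x h1); omega
    · have := hf x ⟨hx, h1⟩; omega
    · have := hf x ⟨hx, h1⟩; omega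
  · have hcross : ∀ x ∈ K, ∀ z ∈ K, G.Adj (p a) x → ¬ G.Adj (p a) z → G.Adj x z →
        e x ≠ if g z then 2 * τ + f z else f z := by
      intro x hx z hz hax haz hxz
      rw [hg z ⟨hz, haz⟩ ⟨x, ⟨hx, hax⟩, hxz.symm⟩, if_pos rfl]
      have := he x (hb x hax); omega
    intro x hx z hz hxz
    by_cases h : G.Adj (p a) x <;> by_cases h' : G.Adj (p a) z <;>
      simp only [h, h', if_true, if_false]
    · exact hep x (hb x h) z (hb z h') hxz
    · exact hcross x hx z hz h h' hxz
    · exact (hcross z hz x hx h' h hxz.symm).symm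
    · have h1 := hf x ⟨hx, h⟩
      have h2 := hf z ⟨hz, h'⟩
      have h3 := hfp x ⟨hx, h⟩ z ⟨hz, h'⟩ hxz
      cases hgx : g x <;> cases hgz : g z <;> simp [hgx, hgz] at h3 ⊢ <;> omega

end

end SimpleGraph

/-! ### Walks and induced paths given by sequences. -/

namespace SimpleGraph

/-- A sequence of successively adjacent vertices, as a walk. -/
theorem exists_walk_of_seq {V : Type*} {G : SimpleGraph V} (p : ℕ → V) (a n : ℕ)
    (hadj : ∀ i, a ≤ i → i < a + n → G.Adj (p i) (p (i + 1))) {x y : V} (hx : x = p a)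
    (hy : y = p (a + n)) :
    ∃ q : G.Walk x y, q.length = n ∧
      (∀ v, v ∈ q.support ↔ ∃ i, a ≤ i ∧ i ≤ a + n ∧ v = p i) ∧
      (∀ d, d ∈ q.edges ↔ ∃ i, a ≤ i ∧ i < a + n ∧ d = s(p i, p (i + 1))) ∧
      ((∀ i j, a ≤ i → i ≤ a + n → a ≤ j → j ≤ a + n → p i = p j → i = j) → q.IsPath) := by
  induction n generalizing a x with
  | zero =>
    obtain rfl : y = x := by rw [hy, hx, add_zero]
    subst hx
    refine ⟨Walk.nil, rfl, fun v => ?_, fun d => ?_, fun _ => Walk.IsPath.nil⟩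
    · simp only [Walk.support_nil, List.mem_singleton, add_zero]
      constructor
      · rintro rfl; exact ⟨a, le_rfl, le_rfl, rfl⟩
      · rintro ⟨i, h1, h2, rfl⟩; rw [le_antisymm h1 h2]
    · simp only [Walk.edges_nil, List.not_mem_nil, false_iff]
      rintro ⟨i, h1, h2, -⟩; omega
  | succ n ih =>
    obtain ⟨q, hl, hs, he, hp⟩ := ih (a + 1) (fun i h1 h2 => hadj i (by omega) (by omega)) rfl
      (by rw [hy]; congr 1; omega)
    subst hx
    refine ⟨Walk.cons (hadj a le_rfl (by omega)) q, by simp [hl], fun v => ?_, fun d => ?_,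
      fun hinj => ?_⟩
    · rw [Walk.support_cons, List.mem_cons, hs]
      constructor
      · rintro (rfl | ⟨i, h1, h2, rfl⟩)
        · exact ⟨a, le_rfl, by omega, rfl⟩
        · exact ⟨i, by omega, by omega, rfl⟩
      · rintro ⟨i, h1, h2, rfl⟩
        rcases h1.eq_or_lt with rfl | h1
        · exact Or.inl rfl
        · exact Or.inr ⟨i, by omega, by omega, rfl⟩
    · rw [Walk.edges_cons, List.mem_cons, he]
      constructor
      · rintro (rfl | ⟨i, h1, h2, rfl⟩)
        · exact ⟨a, le_rfl, by omega, rfl⟩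
        · exact ⟨i, by omega, by omega, rfl⟩
      · rintro ⟨i, h1, h2, rfl⟩
        rcases h1.eq_or_lt with rfl | h1
        · exact Or.inl rfl
        · exact Or.inr ⟨i, by omega, by omega, rfl⟩
    · rw [Walk.cons_isPath_iff]
      refine ⟨hp fun i j h1 h2 h3 h4 => hinj i j (by omega) (by omega) (by omega) (by omega), ?_⟩
      rw [hs]
      rintro ⟨i, h1, h2, h⟩
      have := hinj a i le_rfl (by omega) (by omega) (by omega) h
      omega

variable {V : Type*} {G : SimpleGraph V}

/-- A connected set `X` touched by `x` and `y` contains the interior of an induced path from `x`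
to `y`. -/
theorem exists_induced_seq {X : Set V} {x y : V} (hX : G.ConnOn X) (hx : G.Touches x X)
    (hy : G.Touches y X) {n : ℕ} (hxy : y ∉ G.ballOn x n) :
    ∃ (L : ℕ) (P : ℕ → V), n < L ∧ P 0 = x ∧ P L = y ∧ (∀ i, i < L → G.Adj (P i) (P (i + 1))) ∧
      (∀ i j, i ≤ L → j ≤ L → P i = P j → i = j) ∧
      (∀ i j, i ≤ L → j ≤ L → G.Adj (P i) (P j) → i = j + 1 ∨ j = i + 1) ∧
      ∀ i, 0 < i → i < L → P i ∈ X := by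
  set S := insert y (insert x X) with hS
  have hxS : x ∈ S := by simp [hS]
  have hyS : y ∈ S := by simp [hS]
  have hconn : G.ConnOn S :=
    (hX.union_singleton hx).union_singleton (hy.mono (Set.subset_insert _ _))
  obtain ⟨q, hq⟩ := (hconn x hxS y hyS).exists_walk_length_eq_dist
  -- On a shortest path inside `S`, position equals distance from `x`. Hence positions of adjacent
  -- vertices differ by one, and the path is induced.
  have hdist : ∀ i ≤ q.length, (G.within S).dist x (q.getVert i) = i := by
    intro i hi
    have h1 : (G.within S).dist x (q.getVert i) ≤ i := by
      have := dist_le (q.take i)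
      rwa [Walk.take_length, min_eq_left hi] at this
    obtain ⟨r, hr⟩ := (q.take i).reachable.exists_walk_length_eq_dist
    have h2 := dist_le (r.append (q.drop i))
    rw [Walk.length_append, Walk.drop_length, hr, ← hq] at h2
    omega
  have hmem : ∀ i, q.getVert i ∈ S := fun i =>
    mem_support_of_within q hxS (q.getVert_mem_support i)
  have hstep : ∀ i j, i ≤ q.length → j ≤ q.length → G.Adj (q.getVert i) (q.getVert j) →
      j ≤ i + 1 := by
    intro i j hi hj hij
    have hw : (G.within S).Adj (q.getVert i) (q.getVert j) := ⟨hij, hmem i, hmem j⟩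
    obtain ⟨r, hr⟩ := (q.take i).reachable.exists_walk_length_eq_dist
    have h2 := dist_le (r.append (Walk.cons hw Walk.nil))
    rw [Walk.length_append, hr, hdist i hi, hdist j hj] at h2
    simpa using h2
  have hinj : ∀ i j, i ≤ q.length → j ≤ q.length → q.getVert i = q.getVert j → i = j := by
    intro i j hi hj h
    rw [← hdist i hi, ← hdist j hj, h]
  refine ⟨q.length, q.getVert, ?_, q.getVert_zero, q.getVert_length,
    fun i hi => (q.adj_getVert_succ hi).1, hinj, ?_, ?_⟩
  · by_contra hc
    refine hxy ?_
    have h1 := edist_le (q.mapLe (within_le S))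
    simp only [ballOn, Set.mem_ofPred_eq]
    refine h1.trans ?_
    rw [Walk.length_map]
    exact_mod_cast not_lt.1 hc
  · intro i j hi hj hij
    have h1 := hstep i j hi hj hij
    have h2 := hstep j i hj hi hij.symm
    have h3 : i ≠ j := by rintro rfl; exact G.loopless.irrefl _ hij
    omega
  · intro i h0 hi
    rcases hmem i with h | h | h
    · have := hinj i q.length hi.le le_rfl (by rw [h, q.getVert_length]); omega
    · have := hinj i 0 hi.le (by omega) (by rw [h, q.getVert_zero]); omega
    · exact h

end SimpleGraph

namespace SimpleGraph

theorem Walk.mem_edges_iff_exists_getVert {V : Type*} {G : SimpleGraph V} {x y : V}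
    (p : G.Walk x y) (d : Sym2 V) :
    d ∈ p.edges ↔ ∃ i < p.length, d = s(p.getVert i, p.getVert (i + 1)) := by
  induction p with
  | nil => simp
  | cons h p ih =>
    rw [edges_cons, List.mem_cons, ih]
    constructor
    · rintro (rfl | ⟨i, hi, rfl⟩)
      · exact ⟨0, by simp, by simp⟩
      · exact ⟨i + 1, by simpa using hi, by simp⟩
    · rintro ⟨i, hi, rfl⟩
      cases i with
      | zero => left; simp
      | succ i => exact Or.inr ⟨i, by simpa using hi, by simp⟩

/-- Consecutive pairs of an injective sequence determine their position. -/
theorem eq_of_sym2_eq {V : Type*} {f : ℕ → V} {n : ℕ}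
    (hf : ∀ i j, i ≤ n → j ≤ n → f i = f j → i = j) {i j : ℕ} (hi : i < n) (hj : j < n)
    (h : s(f i, f (i + 1)) = s(f j, f (j + 1))) : i = j := by
  rw [Sym2.eq_iff] at h
  rcases h with ⟨h, -⟩ | ⟨h1, h2⟩
  · exact hf i j hi.le hj.le h
  · have e1 := hf _ _ hi.le hj h1
    have e2 := hf _ _ hi hj.le h2
    omega

end SimpleGraph

/-! ### From centres and connecting sets to an induced subdivision. -/

open SimpleGraph

/-- A system of far apart centres for the vertices of `H` and pairwise anticomplete connected sets
for the edges of `H`, touched exactly by the centres of the ends, yields an induced subdivision of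
any given subdivision `J` of `H`. -/
theorem SubdivisionModel.not_subdivisionFree {α β W V : Type*} {H : Graph α β} {J : SimpleGraph W}
    {G : SimpleGraph V} [Finite W] (S : SubdivisionModel H J) (c : H.vertexSet → V)
    (X : H.edgeSet → Set V)
    (hfar : ∀ x y, x ≠ y → c y ∉ G.ballOn (c x) (Nat.card W))
    (hconn : ∀ e, G.ConnOn (X e))
    (htouch : ∀ (e : H.edgeSet) (x y : H.vertexSet), H.IsLink e x y → G.Touches (c x) (X e))
    (hnot : ∀ (e : H.edgeSet) (x y z : H.vertexSet), H.IsLink e x y → z ≠ x → z ≠ y →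
      ¬ G.Touches (c z) (X e))
    (hc : ∀ e z, c z ∉ X e)
    (hanti : ∀ e f, e ≠ f → G.Anticomplete (X e) (X f)) : ¬ SubdivisionFree J G := by
  classical
  have := Fintype.ofFinite W
  have hcinj : ∀ x y, c x = c y → x = y := by
    intro x y h
    by_contra hne
    exact hfar x y hne (h ▸ mem_ballOn_self _ _)
  have hst : ∀ e, S.src e ≠ S.tgt e := by
    intro e h
    have h1 := (S.isPath e).getVert_injOn (x₁ := 0) (x₂ := (S.path e).length) (by simp) (by simp)
      ((Walk.getVert_zero _).trans ((congrArg S.branch h).trans (Walk.getVert_length _).symm))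
    have := S.one_le_length e
    omega
  choose L P hL hP0 hPL hPadj hPinj hPind hPX using fun e =>
    exists_induced_seq (hconn e) (htouch e _ _ (S.isLink e)) (htouch e _ _ (S.isLink e).symm)
      (hfar _ _ (hst e))
  set l : H.edgeSet → ℕ := fun e => (S.path e).length with hl
  set R : H.edgeSet → ℕ → W := fun e => (S.path e).getVert with hR
  -- A path of `J` has length less than `|W|`, and the centres are at distance more than `|W|`.
  have hlL : ∀ e, l e < L e := fun e =>
    ((S.isPath e).length_lt.trans_eq Nat.card_eq_fintype_card.symm).trans (hL e)
  have hl1 : ∀ e, 0 < l e := S.one_le_length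
  have hR0 : ∀ e, R e 0 = S.branch (S.src e) := fun e => Walk.getVert_zero _
  have hRl : ∀ e, R e (l e) = S.branch (S.tgt e) := fun e => Walk.getVert_length _
  have hRinj : ∀ e i j, i ≤ l e → j ≤ l e → R e i = R e j → i = j := fun e i j hi hj h =>
    (S.isPath e).getVert_injOn hi hj h
  have hRs : ∀ e i, R e i ∈ (S.path e).support := fun e i => Walk.getVert_mem_support _ _
  have hRb : ∀ e i v, 0 < i → i < l e → R e i ≠ S.branch v := by
    intro e i v h0 hi h
    rcases S.eq_end_of_mem e v (h ▸ hRs e i) with rfl | rfl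
    · have := hRinj e i 0 hi.le (by omega) (by rw [h, hR0]); omega
    · have := hRinj e i (l e) hi.le le_rfl (by rw [h, hRl]); omega
  have hRR : ∀ e f i j, 0 < i → i < l e → 0 < j → j < l f → R e i = R f j → e = f ∧ i = j := by
    intro e f i j h0 hi h0' hj h
    have hef : e = f := by
      by_contra hne
      obtain ⟨v, hv⟩ := S.disjoint e f hne _ (hRs e i) (h ▸ hRs f j)
      exact hRb e i v h0 hi hv.symm
    subst hef
    exact ⟨rfl, hRinj e i j hi.le hj.le h⟩
  have hcover : ∀ w, (∃ v, S.branch v = w) ∨ ∃ e i, 0 < i ∧ i < l e ∧ R e i = w := by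
    intro w
    rcases S.vertex_cover w with ⟨v, hv⟩ | ⟨e, he⟩
    · exact Or.inl ⟨v, hv⟩
    · obtain ⟨i, hi, hle⟩ := (Walk.mem_support_iff_exists_getVert).1 he
      rcases Nat.eq_zero_or_pos i with rfl | h0
      · exact Or.inl ⟨_, (hR0 e).symm.trans hi⟩
      · rcases hle.eq_or_lt with rfl | hlt
        · exact Or.inl ⟨_, (hRl e).symm.trans hi⟩
        · exact Or.inr ⟨e, i, h0, hlt, hi⟩
  have hφ : ∀ w, ∃ u, (∀ v, S.branch v = w → u = c v) ∧
      ∀ e i, 0 < i → i < l e → R e i = w → u = P e i := by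
    intro w
    rcases hcover w with ⟨v, rfl⟩ | ⟨e, i, h0, hi, rfl⟩
    · exact ⟨c v, fun v' h => by rw [S.branch_injective h],
        fun e i h0 hi h => absurd h (hRb e i v h0 hi)⟩
    · refine ⟨P e i, fun v' h => absurd h.symm (hRb e i v' h0 hi), fun f j h0' hj h => ?_⟩
      obtain ⟨rfl, rfl⟩ := hRR f e j i h0' hj h0 hi h
      rfl
  choose φ hφb' hφR' using hφ
  have hφb : ∀ v, φ (S.branch v) = c v := fun v => hφb' _ v rfl
  have hφR : ∀ e i, 0 < i → i < l e → φ (R e i) = P e i := fun e i h0 hi => hφR' _ e i h0 hi rfl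
  have hPeq : ∀ e f i j, 0 < i → i < L e → j ≤ L f → P e i = P f j → e = f ∧ i = j := by
    intro e f i j h0 hi hj h
    have hmem := hPX e i h0 hi
    rcases Nat.eq_zero_or_pos j with rfl | h0'
    · rw [h, hP0] at hmem; exact absurd hmem (hc _ _)
    rcases hj.eq_or_lt with rfl | hj'
    · rw [h, hPL] at hmem; exact absurd hmem (hc _ _)
    have hef : e = f := by
      by_contra hne
      exact (hanti e f hne _ hmem _ (hPX f j h0' hj')).1 h
    subst hef
    exact ⟨rfl, hPinj e i j hi.le hj h⟩
  -- Position on `P e` of the `i`-th vertex of the path `R e` of `J`. All excess length goes to the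
  -- last edge of `R e`; the other edges are not subdivided.
  set σ : H.edgeSet → ℕ → ℕ := fun e i => if i < l e then i else L e with hσ
  have hσlt : ∀ e i, i < l e → σ e i = i := fun e i hi => if_pos hi
  have hσl : ∀ e, σ e (l e) = L e := fun e => if_neg (lt_irrefl _)
  have hσle : ∀ e i, i ≤ l e → σ e i ≤ L e := by
    intro e i hi
    have := hlL e
    simp only [hσ]; split_ifs <;> omega
  have hσmono : ∀ e i j, i ≤ l e → j ≤ l e → i < j → σ e i < σ e j := by
    intro e i j hi hj hij
    have := hlL e
    simp only [hσ]; split_ifs <;> omega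
  have hφσ : ∀ e i, i ≤ l e → φ (R e i) = P e (σ e i) := by
    intro e i hi
    rcases hi.eq_or_lt with rfl | hi
    · rw [hσl, hRl, hφb, hPL]
    · rw [hσlt e i hi]
      rcases Nat.eq_zero_or_pos i with rfl | h0
      · rw [hR0, hφb, hP0]
      · exact hφR e i h0 hi
  have hφinj : Function.Injective φ := by
    intro w w' h
    rcases hcover w with ⟨v, rfl⟩ | ⟨e, i, h0, hi, rfl⟩ <;>
      rcases hcover w' with ⟨v', rfl⟩ | ⟨f, j, h0', hj, rfl⟩
    · rw [hφb, hφb] at h; rw [hcinj _ _ h]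
    · rw [hφb, hφR f j h0' hj] at h
      exact absurd (h ▸ hPX f j h0' (hj.trans (hlL f))) (hc f v)
    · rw [hφb, hφR e i h0 hi] at h
      exact absurd (h ▸ hPX e i h0 (hi.trans (hlL e))) (hc e v')
    · rw [hφR e i h0 hi, hφR f j h0' hj] at h
      obtain ⟨rfl, rfl⟩ := hPeq e f i j h0 (hi.trans (hlL e)) (hj.trans (hlL f)).le h
      rfl
  have hφback : ∀ e k w, k ≤ L e → φ w = P e k → ∃ i ≤ l e, w = R e i ∧ k = σ e i := by
    intro e k w hk h
    rcases Nat.eq_zero_or_pos k with rfl | h0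
    · refine ⟨0, Nat.zero_le _, hφinj ?_, (hσlt e 0 (hl1 e)).symm⟩
      rw [h, hφσ e 0 (Nat.zero_le _), hσlt e 0 (hl1 e)]
    rcases hk.eq_or_lt with rfl | hk
    · refine ⟨l e, le_rfl, hφinj ?_, (hσl e).symm⟩
      rw [h, hφσ e _ le_rfl, hσl]
    rcases hcover w with ⟨v, rfl⟩ | ⟨f, j, h0', hj, rfl⟩
    · rw [hφb] at h
      exact absurd (h ▸ hPX e k h0 hk) (hc e v)
    · rw [hφR f j h0' hj] at h
      obtain ⟨rfl, rfl⟩ := hPeq e f k j h0 hk (hj.trans (hlL f)).le h.symm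
      exact ⟨k, hj.le, rfl, (hσlt e k hj).symm⟩
  set s : Set V := {v | (∃ x, v = c x) ∨ ∃ e k, k ≤ L e ∧ v = P e k} with hs
  have hPs : ∀ e k, k ≤ L e → P e k ∈ s := fun e k hk => Or.inr ⟨e, k, hk, rfl⟩
  have hφs : ∀ w, φ w ∈ s := by
    intro w
    rcases hcover w with ⟨v, rfl⟩ | ⟨e, i, h0, hi, rfl⟩
    · exact Or.inl ⟨v, hφb v⟩
    · rw [hφR e i h0 hi]; exact hPs e i (hi.trans (hlL e)).le
  have hsmem : ∀ v ∈ s, (∃ x, v = c x) ∨ ∃ e k, 0 < k ∧ k < L e ∧ v = P e k := by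
    rintro v (h | ⟨e, k, hk, rfl⟩)
    · exact Or.inl h
    · rcases Nat.eq_zero_or_pos k with rfl | h0
      · exact Or.inl ⟨_, hP0 e⟩
      rcases hk.eq_or_lt with rfl | hk
      · exact Or.inl ⟨_, hPL e⟩
      · exact Or.inr ⟨e, k, h0, hk, rfl⟩
  -- an edge inside `s` with an end in the interior of a path belongs to that path
  have hedge1 : ∀ e i, 0 < i → i < L e → ∀ y ∈ s, G.Adj (P e i) y →
      ∃ j ≤ L e, y = P e j := by
    intro e i h0 hi y hy hxy
    rcases hsmem y hy with ⟨v, rfl⟩ | ⟨f, j, h0', hj, rfl⟩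
    · by_cases hv : v = S.src e
      · exact ⟨0, by omega, by rw [hP0, hv]⟩
      by_cases hv' : v = S.tgt e
      · exact ⟨L e, le_rfl, by rw [hPL, hv']⟩
      · exact absurd ⟨_, hPX e i h0 hi, hxy.symm⟩ (hnot e _ _ v (S.isLink e) hv hv')
    · have hef : e = f := by
        by_contra hne
        exact (hanti e f hne _ (hPX e i h0 hi) _ (hPX f j h0' hj)).2 hxy
      subst hef
      exact ⟨j, hj.le, rfl⟩
  have hedge2 : ∀ e i j, i ≤ L e → j ≤ L e → G.Adj (P e i) (P e j) →
      ∃ k < L e, s(P e i, P e j) = s(P e k, P e (k + 1)) := by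
    intro e i j hi hj hij
    rcases hPind e i j hi hj hij with rfl | rfl
    · exact ⟨j, by omega, Sym2.eq_swap⟩
    · exact ⟨i, by omega, rfl⟩
  have hedge : ∀ x ∈ s, ∀ y ∈ s, G.Adj x y →
      ∃ e, ∃ k < L e, s(x, y) = s(P e k, P e (k + 1)) := by
    intro x hx y hy hxy
    rcases hsmem x hx with ⟨v, rfl⟩ | ⟨e, i, h0, hi, rfl⟩
    · rcases hsmem y hy with ⟨v', rfl⟩ | ⟨e, i, h0, hi, rfl⟩
      · exfalso
        have hne : v ≠ v' := by rintro rfl; exact G.loopless.irrefl _ hxy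
        have hW : 1 ≤ Nat.card W := Nat.card_pos_iff.2 ⟨⟨S.branch v⟩, inferInstance⟩
        exact hfar v v' hne (ballOn_mono _ hW (mem_ballOn_one hxy))
      · obtain ⟨j, hj, h⟩ := hedge1 e i h0 hi _ hx hxy.symm
        rw [h] at hxy ⊢
        exact ⟨e, hedge2 e j i hj hi.le hxy⟩
    · obtain ⟨j, hj, rfl⟩ := hedge1 e i h0 hi y hy hxy
      exact ⟨e, hedge2 e i j hi.le hj hxy⟩
  -- Truncating the index at `L e` only serves to make the sequence total with values in `s`.
  set P' : H.edgeSet → ℕ → s := fun e k => ⟨P e (min k (L e)), hPs e _ (min_le_right _ _)⟩ with hP'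
  have hP'v : ∀ e k, k ≤ L e → (P' e k : V) = P e k := by
    intro e k hk
    simp only [hP', min_eq_left hk]
  have hJ : ∀ d : (Graph.ofSimpleGraph J).edgeSet, ∃ e, ∃ i < l e,
      (d : Sym2 W) = s(R e i, R e (i + 1)) := by
    intro d
    obtain ⟨e, he, -⟩ := S.edge_cover d d.2
    exact ⟨e, ((S.path e).mem_edges_iff_exists_getVert _).1 he⟩
  choose E I hI hEI using hJ
  have huniq : ∀ (d : (Graph.ofSimpleGraph J).edgeSet) e i, i < l e →
      (d : Sym2 W) = s(R e i, R e (i + 1)) → E d = e ∧ I d = i := by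
    intro d e i hi h
    have hmem : ∀ e i, i < l e → (d : Sym2 W) = s(R e i, R e (i + 1)) →
        (d : Sym2 W) ∈ (S.path e).edges := fun e i hi h =>
      ((S.path e).mem_edges_iff_exists_getVert _).2 ⟨i, hi, h⟩
    have hE : E d = e := (S.edge_cover d d.2).unique (hmem _ _ (hI d) (hEI d)) (hmem e i hi h)
    subst hE
    exact ⟨rfl, eq_of_sym2_eq (hRinj _) (hI d) hi ((hEI d).symm.trans h)⟩
  have hex : ∀ e i, i < l e → ∃ d : (Graph.ofSimpleGraph J).edgeSet, E d = e ∧ I d = i := by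
    intro e i hi
    let d : (Graph.ofSimpleGraph J).edgeSet :=
      ⟨s(R e i, R e (i + 1)), (S.path e).adj_getVert_succ hi⟩
    exact ⟨d, huniq d e i hi rfl⟩
  have hwalk : ∀ d : (Graph.ofSimpleGraph J).edgeSet,
      ∃ q : (G.induce s).Walk ⟨φ (R (E d) (I d)), hφs _⟩ ⟨φ (R (E d) (I d + 1)), hφs _⟩,
        1 ≤ q.length ∧ q.IsPath ∧
        (∀ v, v ∈ q.support ↔ ∃ k, σ (E d) (I d) ≤ k ∧ k ≤ σ (E d) (I d + 1) ∧ v = P' (E d) k) ∧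
        ∀ m, m ∈ q.edges ↔ ∃ k, σ (E d) (I d) ≤ k ∧ k < σ (E d) (I d + 1) ∧
          m = s(P' (E d) k, P' (E d) (k + 1)) := by
    intro d
    have h1 := hσmono (E d) (I d) (I d + 1) (hI d).le (hI d) (Nat.lt_succ_self _)
    have h2 := hσle (E d) (I d + 1) (hI d)
    obtain ⟨q, hql, hqs, hqe, hqp⟩ := exists_walk_of_seq (G := G.induce s) (P' (E d))
      (σ (E d) (I d)) (σ (E d) (I d + 1) - σ (E d) (I d))
      (fun k _ hk => by
        simp only [comap_adj, Function.Embedding.subtype_apply]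
        rw [hP'v _ _ (by omega), hP'v _ _ (by omega)]
        exact hPadj (E d) k (by omega))
      (x := ⟨φ (R (E d) (I d)), hφs _⟩) (y := ⟨φ (R (E d) (I d + 1)), hφs _⟩)
      (Subtype.ext (by rw [hP'v _ _ (by omega)]; exact hφσ _ _ (hI d).le))
      (Subtype.ext (by
        rw [hP'v _ _ (by omega), Nat.add_sub_cancel' h1.le]; exact hφσ _ _ (hI d)))
    rw [Nat.add_sub_cancel' h1.le] at hqs hqe hqp
    refine ⟨q, by omega, hqp fun i j _ hi _ hj h => ?_, hqs, hqe⟩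
    have := congrArg Subtype.val h
    rw [hP'v _ _ (by omega), hP'v _ _ (by omega)] at this
    exact hPinj _ i j (by omega) (by omega) this
  choose q hq1 hqp hqs hqe using hwalk
  intro hfree
  refine hfree ⟨s, ⟨{
    branch := fun w => ⟨φ w, hφs w⟩
    branch_injective := fun w w' h => Subtype.ext (hφinj (congrArg Subtype.val h))
    src := fun d => ⟨R (E d) (I d), Set.mem_univ _⟩
    tgt := fun d => ⟨R (E d) (I d + 1), Set.mem_univ _⟩
    isLink := fun d => ⟨hEI d, d.2⟩
    path := q
    isPath := hqp
    one_le_length := hq1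
    eq_end_of_mem := ?_
    disjoint := ?_
    vertex_cover := ?_
    edge_cover := ?_ }⟩⟩
  · intro d w hw
    obtain ⟨k, h1, h2, h3⟩ := (hqs d _).1 hw
    have hk := h2.trans (hσle _ _ (hI d))
    have h4 := congrArg Subtype.val h3
    rw [hP'v _ _ hk] at h4
    obtain ⟨i, hi, hwi, rfl⟩ := hφback _ _ _ hk h4
    have h5 : I d ≤ i := by
      by_contra hc'
      have := hσmono (E d) i (I d) hi (hI d).le (by omega); omega
    have h6 : i ≤ I d + 1 := by
      by_contra hc'
      have := hσmono (E d) (I d + 1) i (hI d) hi (by omega); omega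
    have h7 : i = I d ∨ i = I d + 1 := by omega
    rcases h7 with rfl | rfl
    · exact Or.inl (Subtype.ext hwi)
    · exact Or.inr (Subtype.ext hwi)
  · intro d d' hne x hx hx'
    obtain ⟨k, h1, h2, h3⟩ := (hqs d _).1 hx
    obtain ⟨k', h1', h2', h3'⟩ := (hqs d' _).1 hx'
    have hk := h2.trans (hσle _ _ (hI d))
    have hk' := h2'.trans (hσle _ _ (hI d'))
    have hx1 : (x : V) = P (E d) k := by rw [h3, hP'v _ _ hk]
    have hx2 : (x : V) = P (E d') k' := by rw [h3', hP'v _ _ hk']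
    have hfin : ∀ i ≤ l (E d), k = σ (E d) i → x ∈ Set.range fun w :
        (Graph.ofSimpleGraph J).vertexSet => (⟨φ w, hφs w⟩ : s) := fun i hi h =>
      ⟨⟨R (E d) i, Set.mem_univ _⟩, Subtype.ext (by rw [hx1, h]; exact hφσ _ _ hi)⟩
    rcases Nat.eq_zero_or_pos k with h0 | h0
    · exact hfin 0 (Nat.zero_le _) (by rw [h0, hσlt _ _ (hl1 _)])
    rcases hk.eq_or_lt with hkL | hkL
    · exact hfin _ le_rfl (by rw [hkL, hσl])
    obtain ⟨hE, rfl⟩ := hPeq _ _ k k' h0 hkL hk' (hx1.symm.trans hx2)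
    have hII : I d ≠ I d' := by
      intro hII
      apply hne
      apply Subtype.ext
      rw [hEI d, hEI d', hE, hII]
    rw [← hE] at h1' h2'
    have hId' : I d' < l (E d) := hE ▸ hI d'
    rcases lt_or_gt_of_ne hII with h | h
    · refine hfin (I d + 1) (hI d) (le_antisymm h2 (le_trans ?_ h1'))
      rcases (Nat.succ_le_of_lt h).eq_or_lt with h | h
      · rw [← h]
      · exact (hσmono _ _ _ (hI d) hId'.le h).le
    · refine hfin (I d) (hI d).le (le_antisymm (le_trans h2' ?_) h1)
      rcases (Nat.succ_le_of_lt h).eq_or_lt with h | h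
      · rw [← h]
      · exact (hσmono _ _ _ hId' (hI d).le h).le
  · rintro ⟨x, ⟨v, rfl⟩ | ⟨e, k, hk, rfl⟩⟩
    · exact Or.inl ⟨⟨S.branch v, Set.mem_univ _⟩, Subtype.ext (hφb v)⟩
    · right
      have hle := hlL e
      have hl1e := hl1 e
      obtain ⟨i, hi, h1, h2⟩ : ∃ i < l e, σ e i ≤ k ∧ k ≤ σ e (i + 1) := by
        by_cases hkl : k + 1 < l e
        · exact ⟨k, by omega, by rw [hσlt e k (by omega)], by rw [hσlt e _ hkl]; omega⟩
        · refine ⟨l e - 1, by omega, ?_, ?_⟩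
          · rw [hσlt e _ (by omega)]; omega
          · rw [Nat.sub_add_cancel hl1e, hσl]; exact hk
      obtain ⟨d, rfl, rfl⟩ := hex e i hi
      exact ⟨d, (hqs d _).2 ⟨k, h1, h2, Subtype.ext (hP'v _ _ hk).symm⟩⟩
  · intro m hm
    induction m using Sym2.ind with
    | _ x y =>
    obtain ⟨e, k, hk, hxy⟩ := hedge x x.2 y y.2 hm
    have hlift : s(x, y) = s(P' e k, P' e (k + 1)) := by
      apply Sym2.map.injective Subtype.val_injective
      simp only [Sym2.map_mk]
      rw [hP'v _ _ hk.le, hP'v _ _ hk]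
      exact hxy
    have hle := hlL e
    have hl1e := hl1 e
    obtain ⟨i, hi, h1, h2⟩ : ∃ i < l e, σ e i ≤ k ∧ k < σ e (i + 1) := by
      by_cases hkl : k + 1 < l e
      · exact ⟨k, by omega, by rw [hσlt e k (by omega)], by rw [hσlt e _ hkl]; omega⟩
      · refine ⟨l e - 1, by omega, ?_, ?_⟩
        · rw [hσlt e _ (by omega)]; omega
        · rw [Nat.sub_add_cancel hl1e, hσl]; exact hk
    obtain ⟨d, rfl, rfl⟩ := hex e i hi
    refine ⟨d, (hqe d _).2 ⟨k, h1, h2, hlift⟩, ?_⟩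
    intro d' hd'
    obtain ⟨k', h1', h2', hk'⟩ := (hqe d' _).1 hd'
    have hk'L := lt_of_lt_of_le h2' (hσle _ _ (hI d'))
    have hxy' : s(P (E d) k, P (E d) (k + 1)) = s(P (E d') k', P (E d') (k' + 1)) := by
      have := congrArg (Sym2.map Subtype.val) hk'
      simp only [Sym2.map_mk] at this
      rw [hP'v _ _ hk'L.le, hP'v _ _ hk'L] at this
      exact hxy.symm.trans this
    have hE : E d = E d' := by
      -- As `L e > l e ≥ 1`, each edge of `P e` has an end in the interior of the path, which
      -- determines `e`.
      have hint : ∃ j, 0 < j ∧ j < L (E d) ∧ P (E d) j ∈ s(P (E d) k, P (E d) (k + 1)) := by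
        rcases Nat.eq_zero_or_pos k with h0 | h0
        · exact ⟨k + 1, by omega, by omega, Sym2.mem_mk_right _ _⟩
        · exact ⟨k, h0, hk, Sym2.mem_mk_left _ _⟩
      obtain ⟨j, h0, hj, hmem⟩ := hint
      rw [hxy', Sym2.mem_iff] at hmem
      rcases hmem with h | h
      · exact (hPeq _ _ j k' h0 hj hk'L.le h).1
      · exact (hPeq _ _ j (k' + 1) h0 hj hk'L h).1
    rw [← hE] at hxy' h1' h2' hk'L
    have hkk := eq_of_sym2_eq (hPinj (E d)) hk hk'L hxy'
    subst hkk
    have hId' : I d' < l (E d) := hE ▸ hI d'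
    have hII : I d' = I d := by
      rcases lt_trichotomy (I d') (I d) with h | h | h
      · exfalso
        have : σ (E d) (I d' + 1) ≤ σ (E d) (I d) := by
          rcases (Nat.succ_le_of_lt h).eq_or_lt with h | h
          · rw [← h]
          · exact (hσmono _ _ _ hId' (hI d).le h).le
        omega
      · exact h
      · exfalso
        have : σ (E d) (I d + 1) ≤ σ (E d) (I d') := by
          rcases (Nat.succ_le_of_lt h).eq_or_lt with h | h
          · rw [← h]
          · exact (hσmono _ _ _ (hI d) hId'.le h).le
        omega
    apply Subtype.ext
    rw [hEI d, hEI d', hE, hII]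

/-! ### Fat triangles. -/

/-- The shape of a fat triangle: two parallel edges `f₁`, `f₂` join `u` and `v`, all other edges
join `w` to `u` or to `v`. -/
theorem IsFatTriangle.exists_shape {α β : Type*} {H : Graph α β} (hH : IsFatTriangle H) :
    Finite H.edgeSet ∧ ∃ u v w : H.vertexSet, u ≠ v ∧ u ≠ w ∧ v ≠ w ∧
      (∀ x, x = u ∨ x = v ∨ x = w) ∧ ∃ f₁ f₂ : H.edgeSet, f₁ ≠ f₂ ∧ H.IsLink f₁ u v ∧
        H.IsLink f₂ u v ∧ ∀ e : H.edgeSet, e ≠ f₁ → e ≠ f₂ → H.IsLink e u w ∨ H.IsLink e v w := by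
  obtain ⟨F, e₀, he₀⟩ := hH
  have hlink : ∀ (f : H.edgeSet) (i j : Fin 3), ((F.proj f : _) : Sym2 (Fin 3)) = s(i, j) →
      H.IsLink f (F.vert.symm ⟨i, Set.mem_univ _⟩) (F.vert.symm ⟨j, Set.mem_univ _⟩) := by
    intro f i j h
    rw [F.isLink_iff, Equiv.apply_symm_apply, Equiv.apply_symm_apply]
    exact ⟨h, (F.proj f).2⟩
  refine ⟨?_, ?_⟩
  · refine Set.finite_univ_iff.1 ((Set.finite_iUnion F.fiber_finite).subset fun f _ => ?_)
    exact Set.mem_iUnion.2 ⟨F.proj f, rfl⟩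
  · obtain ⟨e, he⟩ := e₀
    induction e using Sym2.ind with
    | _ i j =>
    have hij : i ≠ j := he
    obtain ⟨k, hik, hjk, hk⟩ : ∃ k : Fin 3, i ≠ k ∧ j ≠ k ∧ ∀ t, t = i ∨ t = j ∨ t = k := by
      clear he₀ he
      revert i j; decide
    obtain ⟨f₁, f₂, hf, hfib⟩ := Set.ncard_eq_two.1 he₀
    have hne : ∀ x y : Fin 3, x ≠ y → F.vert.symm ⟨x, Set.mem_univ _⟩ ≠
        F.vert.symm ⟨y, Set.mem_univ _⟩ := fun x y h h' =>
      h (congrArg Subtype.val (F.vert.symm.injective h'))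
    have h1 : F.proj f₁ = ⟨s(i, j), he⟩ := by
      have : f₁ ∈ ({f₁, f₂} : Set _) := by simp
      rwa [← hfib] at this
    have h2 : F.proj f₂ = ⟨s(i, j), he⟩ := by
      have : f₂ ∈ ({f₁, f₂} : Set _) := by simp
      rwa [← hfib] at this
    refine ⟨_, _, _, hne i j hij, hne i k hik, hne j k hjk, fun x => ?_, f₁, f₂, hf,
      hlink _ _ _ (by rw [h1]), hlink _ _ _ (by rw [h2]), fun e he1 he2 => ?_⟩
    · obtain ⟨y, rfl⟩ := F.vert.symm.surjective x
      rcases hk y with h | h | h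
      · exact Or.inl (congrArg _ (Subtype.ext h))
      · exact Or.inr (Or.inl (congrArg _ (Subtype.ext h)))
      · exact Or.inr (Or.inr (congrArg _ (Subtype.ext h)))
    · have h3 : (F.proj e : Sym2 (Fin 3)) ≠ s(i, j) := by
        intro h
        have : e ∈ ({f₁, f₂} : Set _) := by
          rw [← hfib]; exact Subtype.ext h
        rcases this with h | h
        · exact he1 h
        · exact he2 h
      have h4 : ((F.proj e : _) : Sym2 (Fin 3)) = s(i, k) ∨
          ((F.proj e : _) : Sym2 (Fin 3)) = s(j, k) := by
        have h5 := (F.proj e).2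
        generalize ((F.proj e : _) : Sym2 (Fin 3)) = d at h3 h5
        induction d using Sym2.ind with
        | _ x y =>
        have hxy : x ≠ y := h5
        clear h5 h1 h2 hfib he₀ hlink hne
        rcases hk x with rfl | rfl | rfl <;> rcases hk y with rfl | rfl | rfl <;>
          simp_all [Sym2.eq_swap]
      exact h4.imp (hlink e i k) (hlink e j k)

/-! ### Subdivisions of fat triangles found in towers. -/

namespace SimpleGraph

variable {V : Type*} {G : SimpleGraph V}

/-- The set `X` connects `x` and `y` and is not touched by `z`. -/
structure IsConnector (G : SimpleGraph V) (x y z : V) (X : Set V) : Prop where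
  conn : G.ConnOn X
  left : G.Touches x X
  right : G.Touches y X
  third : ¬ G.Touches z X
  left_notMem : x ∉ X
  right_notMem : y ∉ X
  third_notMem : z ∉ X

/-- Connectors for a fat triangle, with the third vertex `β` as a hub. -/
theorem not_subdivisionFree_of_connectors {A B W : Type*} {H : Graph A B} (hH : IsFatTriangle H)
    [Finite W] {J : SimpleGraph W} (hJ : IsSubdivision H J) {α β γ : V}
    (hαβ : β ∉ G.ballOn α (Nat.card W)) (hαγ : γ ∉ G.ballOn α (Nat.card W))
    (hβγ : γ ∉ G.ballOn β (Nat.card W)) {Y Z : Set V} {F : Finset ℕ} {T : ℕ → Set V}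
    (hY : G.IsConnector α γ β Y) (hZ : G.IsConnector α γ β Z) (hYZ : G.Anticomplete Y Z)
    (hF : Nat.card H.edgeSet ≤ F.card)
    (hα : ∀ i ∈ F, ∃ X ⊆ T i, G.IsConnector α β γ X)
    (hγ : ∀ i ∈ F, ∃ X ⊆ T i, G.IsConnector γ β α X)
    (hYT : ∀ i ∈ F, G.Anticomplete Y (T i)) (hZT : ∀ i ∈ F, G.Anticomplete Z (T i))
    (hTT : ∀ i ∈ F, ∀ j ∈ F, i ≠ j → G.Anticomplete (T i) (T j)) : ¬ SubdivisionFree J G := by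
  classical
  obtain ⟨S⟩ := hJ
  obtain ⟨hfin, u, v, w, huv, huw, hvw, hall, f₁, f₂, hf, hf₁, hf₂, hrest⟩ := hH.exists_shape
  have := Fintype.ofFinite H.edgeSet
  obtain ⟨g⟩ : Nonempty (H.edgeSet ↪ F) := by
    refine Function.Embedding.nonempty_of_card_le ?_
    rwa [Fintype.card_coe, ← Nat.card_eq_fintype_card]
  choose! A' hA' hA using hα
  choose! B' hB' hB using hγ
  set c : H.vertexSet → V := fun x => if x = u then α else if x = v then γ else β with hc
  have hcu : c u = α := by simp [hc]
  have hcv : c v = γ := by simp [hc, huv.symm]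
  have hcw : c w = β := by simp [hc, huw.symm, hvw.symm]
  set X : H.edgeSet → Set V := fun e => if e = f₁ then Y else if e = f₂ then Z else
    if H.IsLink e u w then A' (g e) else B' (g e) with hX
  have hX1 : X f₁ = Y := by simp [hX]
  have hX2 : X f₂ = Z := by simp [hX, hf.symm]
  have hX3 : ∀ e : H.edgeSet, e ≠ f₁ → e ≠ f₂ → X e ⊆ T (g e) := by
    intro e h1 h2
    simp only [hX, h1, h2, if_false]
    split_ifs
    · exact hA' _ (g e).2
    · exact hB' _ (g e).2
  have key : ∀ e : H.edgeSet, ∃ x y z : H.vertexSet, H.IsLink e x y ∧ (∀ t, t = x ∨ t = y ∨ t = z) ∧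
      z ≠ x ∧ z ≠ y ∧ G.IsConnector (c x) (c y) (c z) (X e) := by
    intro e
    by_cases h1 : e = f₁
    · subst h1
      exact ⟨u, v, w, hf₁, hall, huw.symm, hvw.symm, by rwa [hcu, hcv, hcw, hX1]⟩
    by_cases h2 : e = f₂
    · subst h2
      exact ⟨u, v, w, hf₂, hall, huw.symm, hvw.symm, by rwa [hcu, hcv, hcw, hX2]⟩
    by_cases h3 : H.IsLink e u w
    · refine ⟨u, w, v, h3, fun t => ?_, huv.symm, hvw, ?_⟩
      · rcases hall t with h | h | h <;> simp [h]
      · rw [hcu, hcv, hcw]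
        simp only [hX, h1, h2, h3, if_true, if_false]
        exact hA _ (g e).2
    · refine ⟨v, w, u, (hrest e h1 h2).resolve_left h3, fun t => ?_, huv, huw, ?_⟩
      · rcases hall t with h | h | h <;> simp [h]
      · rw [hcu, hcv, hcw]
        simp only [hX, h1, h2, h3, if_false]
        exact hB _ (g e).2
  have hends : ∀ (e : H.edgeSet) (x y x' y' : H.vertexSet), H.IsLink e x y → H.IsLink e x' y' →
      (x' = x ∧ y' = y) ∨ (x' = y ∧ y' = x) := by
    intro e x y x' y' h h'
    rcases h'.eq_and_eq_or_eq_and_eq h with ⟨h1, h2⟩ | ⟨h1, h2⟩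
    · exact Or.inl ⟨Subtype.ext h1, Subtype.ext h2⟩
    · exact Or.inr ⟨Subtype.ext h1, Subtype.ext h2⟩
  have hflip : ∀ {x y : V} {n}, y ∉ G.ballOn x n → x ∉ G.ballOn y n :=
    fun h h' => h (mem_ballOn_comm.1 h')
  refine S.not_subdivisionFree c X ?_ ?_ ?_ ?_ ?_ ?_
  · intro x y hxy
    rcases hall x with rfl | rfl | rfl <;> rcases hall y with rfl | rfl | rfl <;>
      first
      | exact absurd rfl hxy
      | (simp only [hcu, hcv, hcw]; assumption)
      | (simp only [hcu, hcv, hcw]; apply hflip; assumption)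
  · intro e
    obtain ⟨x, y, z, -, -, -, -, h⟩ := key e
    exact h.conn
  · intro e x' y' h'
    obtain ⟨x, y, z, hl, -, -, -, h⟩ := key e
    rcases hends e x y x' y' hl h' with ⟨rfl, rfl⟩ | ⟨rfl, rfl⟩
    · exact h.left
    · exact h.right
  · intro e x' y' t h' h1 h2
    obtain ⟨x, y, z, hl, ht, -, -, h⟩ := key e
    have : t = z := by
      rcases hends e x y x' y' hl h' with ⟨rfl, rfl⟩ | ⟨rfl, rfl⟩ <;>
        rcases ht t with h | h | h <;> first | exact h | contradiction
    rw [this]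
    exact h.third
  · intro e t
    obtain ⟨x, y, z, -, ht, -, -, h⟩ := key e
    rcases ht t with rfl | rfl | rfl
    · exact h.left_notMem
    · exact h.right_notMem
    · exact h.third_notMem
  · have h12 : ∀ e : H.edgeSet, e ≠ f₁ → e ≠ f₂ → G.Anticomplete (X f₁) (X e) ∧ G.Anticomplete (X f₂) (X e) := by
      intro e h1 h2
      rw [hX1, hX2]
      exact ⟨(hYT _ (g e).2).mono subset_rfl (hX3 e h1 h2),
        (hZT _ (g e).2).mono subset_rfl (hX3 e h1 h2)⟩
    intro e f hef
    by_cases h1 : e = f₁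
    · subst h1
      by_cases h2 : f = f₂
      · subst h2; rwa [hX1, hX2]
      · exact (h12 f hef.symm h2).1
    by_cases h2 : e = f₂
    · subst h2
      by_cases h3 : f = f₁
      · subst h3; rw [hX1, hX2]; exact hYZ.symm
      · exact (h12 f h3 hef.symm).2
    by_cases h3 : f = f₁
    · subst h3; exact (h12 e h1 h2).1.symm
    by_cases h4 : f = f₂
    · subst h4; exact (h12 e h1 h2).2.symm
    refine (hTT _ (g e).2 _ (g f).2 fun h => hef ?_).mono (hX3 e h1 h2) (hX3 f h3 h4)
    exact g.injective (Subtype.ext h)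

theorem notMem_ballOn_comm {x y : V} {n : ℕ} (h : y ∉ G.ballOn x n) : x ∉ G.ballOn y n :=
  fun h' => h (mem_ballOn_comm.1 h')

theorem not_adj_of_notMem_ballOn {x y z : V} {n : ℕ} (hn : 2 ≤ n) (h : y ∉ G.ballOn x n)
    (hx : G.Adj x z) : ¬ G.Adj y z :=
  fun hy => h (ballOn_mono x hn (mem_ballOn_two hx hy.symm))

/-- Moving two far apart vertices to neighbours keeps them far apart. -/
theorem notMem_ballOn_of_adj {x y x' y' : V} {n m : ℕ} (hn : m + 2 ≤ n) (h : y ∉ G.ballOn x n)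
    (hx : G.Adj x x') (hy : G.Adj y y') : y' ∉ G.ballOn x' m := fun h' =>
  h (ballOn_mono x (by omega : 1 + m + 1 ≤ n) (mem_ballOn_trans
    (mem_ballOn_trans (mem_ballOn_one hx) h') (mem_ballOn_one hy.symm)))

variable {M : ℕ} {C U Q : ℕ → Set V} {q : ℕ → V → V}

/-- Parents at level `j` that touch many later lines: connectors through these lines with a common
hub `q j y`, a connector through the `j`-th line and one through the top. -/
theorem Tower.not_subdivisionFree_of_hub {A B W : Type*} {H : Graph A B} (hH : IsFatTriangle H)
    [Finite W] {J : SimpleGraph W} (hJ : IsSubdivision H J) (hT : G.Tower M C U Q q) {ρ : ℕ}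
    (hρ : Nat.card W + 4 ≤ ρ) {j : ℕ} (hj : j < M) {x y z : V} (hx : x ∈ C M) (hy : y ∈ C M)
    (hz : z ∈ C M) (hxy : y ∉ G.ballOn x ρ) (hxz : z ∉ G.ballOn x ρ) (hyz : z ∉ G.ballOn y ρ)
    {S : Set V} (hS : S ⊆ C M) (hSc : G.ConnOn S) (hSx : G.Touches (q j x) S)
    (hSz : G.Touches (q j z) S) (hSy : ¬ G.Touches (q j y) S) {F : Finset ℕ}
    (hF : Nat.card H.edgeSet ≤ F.card) (hFM : ∀ i ∈ F, j < i ∧ i < M)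
    (hFx : ∀ i ∈ F, ∃ X ⊆ U i, G.ConnOn X ∧ G.Touches (q j x) X ∧ G.Touches (q j y) X ∧
      ¬ G.Touches (q j z) X)
    (hFz : ∀ i ∈ F, ∃ X ⊆ U i, G.ConnOn X ∧ G.Touches (q j z) X ∧ G.Touches (q j y) X ∧
      ¬ G.Touches (q j x) X) : ¬ SubdivisionFree J G := by
  have hpar : ∀ t ∈ C M, q j t ∈ Q j ∧ G.Adj t (q j t) := fun t ht => hT.parent_top hj ht
  -- Passing to parents costs 2 in distance. The remaining bound `|W| + 2` exceeds what the
  -- subdivision needs and also rules out common neighbours of two parents.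
  have hdist : ∀ s ∈ C M, ∀ t ∈ C M, t ∉ G.ballOn s ρ →
      q j t ∉ G.ballOn (q j s) (Nat.card W + 2) := fun s hs t ht h =>
    notMem_ballOn_of_adj hρ h (hpar s hs).2 (hpar t ht).2
  have hdist' : ∀ s ∈ C M, ∀ t ∈ C M, t ∉ G.ballOn s ρ →
      q j t ∉ G.ballOn (q j s) (Nat.card W) := fun s hs t ht h h' =>
    hdist s hs t ht h (ballOn_mono _ (by omega) h')
  have hcommon : ∀ s ∈ C M, ∀ t ∈ C M, t ∉ G.ballOn s ρ →
      ∀ v, G.Adj (q j s) v → ¬ G.Adj (q j t) v := fun s hs t ht h v =>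
    not_adj_of_notMem_ballOn (by omega) (hdist s hs t ht h)
  have hL := hT.layer j hj
  have hQC : ∀ t ∈ C M, ∀ i, j < i → i ≤ M → q j t ∉ C i := fun t ht i hji hi =>
    Set.disjoint_left.1 (hT.Q_disjoint hji hi) (hpar t ht).1
  have hQU : ∀ t ∈ C M, q j t ∉ U j := fun t ht h =>
    Set.disjoint_left.1 hL.disjoint_UQ h (hpar t ht).1
  have hUC : ∀ i ∈ F, U i ⊆ C i := fun i hi => (hT.layer i (hFM i hi).2).subset_U
  -- Far apart parents have no common neighbour, so deleting the neighbours of the hub from `U j`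
  -- leaves the contacts of the other two intact.
  have htouch : ∀ t ∈ C M, t ∉ G.ballOn y ρ → G.Touches (q j t) (U j \ {v | G.Adj (q j y) v}) := by
    intro t ht h
    obtain ⟨v, hv, hadj⟩ := hL.touch _ (hpar t ht).1
    exact ⟨v, ⟨hv, fun h' => hcommon y hy t ht h v h' hadj⟩, hadj⟩
  refine not_subdivisionFree_of_connectors hH hJ (hdist' x hx y hy hxy) (hdist' x hx z hz hxz)
    (hdist' y hy z hz hyz) (Y := U j \ {v | G.Adj (q j y) v}) (Z := S) (F := F) (T := U)
    ⟨hL.conn_diff _ (hpar y hy).1, htouch x hx (notMem_ballOn_comm hxy), htouch z hz hyz, ?_,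
      fun h => hQU x hx h.1, fun h => hQU z hz h.1, fun h => hQU y hy h.1⟩
    ⟨hSc, hSx, hSz, hSy, fun h => hQC x hx M hj le_rfl (hS h),
      fun h => hQC z hz M hj le_rfl (hS h), fun h => hQC y hy M hj le_rfl (hS h)⟩
    ((hT.U_anti hj le_rfl).mono Set.sdiff_subset hS) hF ?_ ?_ ?_ ?_ ?_
  · rintro ⟨v, hv, hadj⟩
    exact hv.2 hadj
  · intro i hi
    obtain ⟨X, hX, h1, h2, h3, h4⟩ := hFx i hi
    have hn : ∀ t ∈ C M, q j t ∉ X := fun t ht h =>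
      hQC t ht i (hFM i hi).1 (hFM i hi).2.le (hUC i hi (hX h))
    exact ⟨X, hX, h1, h2, h3, h4, hn x hx, hn y hy, hn z hz⟩
  · intro i hi
    obtain ⟨X, hX, h1, h2, h3, h4⟩ := hFz i hi
    have hn : ∀ t ∈ C M, q j t ∉ X := fun t ht h =>
      hQC t ht i (hFM i hi).1 (hFM i hi).2.le (hUC i hi (hX h))
    exact ⟨X, hX, h1, h2, h3, h4, hn z hz, hn y hy, hn x hx⟩
  · intro i hi
    exact (hT.U_anti_U hj (hFM i hi).2 (hFM i hi).1.ne).mono Set.sdiff_subset subset_rfl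
  · intro i hi
    exact ((hT.U_anti (hFM i hi).2 le_rfl).mono subset_rfl hS).symm
  · intro i hi k hk hik
    exact hT.U_anti_U (hFM i hi).2 (hFM k hk).2 hik

/-- The hub depends on the line; the factor 3 pays for fixing the most frequent one. Since it is not
known in advance, a triple must offer a route through `C M` for each of the three pairs. -/
theorem Tower.not_subdivisionFree_of_touching {A B W : Type*} {H : Graph A B}
    (hH : IsFatTriangle H) [Finite W] {J : SimpleGraph W} (hJ : IsSubdivision H J)
    (hT : G.Tower M C U Q q) {ρ : ℕ} (hρ : Nat.card W + 4 ≤ ρ) {j : ℕ} (hj : j < M)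
    (htri : G.HasTriple (C M) (q j) ρ) {F : Finset ℕ} (hF : 3 * Nat.card H.edgeSet ≤ F.card)
    (hFM : ∀ i ∈ F, j < i ∧ i < M) (htouch : ∀ i ∈ F, ∀ y ∈ C M, G.Touches (q j y) (U i)) :
    ¬ SubdivisionFree J G := by
  classical
  obtain ⟨x, hx, y, hy, z, hz, hxy, hxz, hyz, ⟨S, hS, s1, s2, s3, s4⟩, ⟨S', hS', t1, t2, t3, t4⟩,
    S'', hS'', r1, r2, r3, r4⟩ := htri
  have hcommon : ∀ s ∈ C M, ∀ t ∈ C M, t ∉ G.ballOn s ρ →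
      ∀ v, G.Adj (q j s) v → ¬ G.Adj (q j t) v := fun s hs t ht h v =>
    not_adj_of_notMem_ballOn (by omega) (notMem_ballOn_of_adj hρ h (hT.parent_top hj hs).2
      (hT.parent_top hj ht).2)
  set av : V → V → V → ℕ → Prop := fun x y z i => ∃ X ⊆ U i, G.ConnOn X ∧ G.Touches (q j x) X ∧
    G.Touches (q j y) X ∧ ¬ G.Touches (q j z) X with hav
  have hswap : ∀ {x y z i}, av x y z i → av y x z i := by
    rintro x y z i ⟨X, h1, h2, h3, h4, h5⟩
    exact ⟨X, h1, h2, h4, h3, h5⟩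
  have hconn : ∀ x ∈ C M, ∀ y ∈ C M, ∀ z ∈ C M, z ∉ G.ballOn y ρ → ∀ i ∈ F,
      av x y z i ∨ av x z y i := fun x hx y hy z hz h i hi =>
    exists_connection (hT.layer i (hFM i hi).2).conn (htouch i hi x hx) (htouch i hi y hy)
      (hcommon y hy z hz h)
  set F₁ := F.filter fun i => av x y z i ∧ av z y x i
  set F₂ := F.filter fun i => av y x z i ∧ av z x y i
  set F₃ := F.filter fun i => av x z y i ∧ av y z x i
  -- On each line, `exists_connection` joins each of the three parents to one of the others. At
  -- least two of the three pairs arise, and two pairs share a vertex, the hub.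
  have hsub : F ⊆ F₁ ∪ F₂ ∪ F₃ := by
    intro i hi
    have h1 := hconn x hx y hy z hz hyz i hi
    have h2 := hconn y hy x hx z hz hxz i hi
    have h3 := hconn z hz x hx y hy hxy i hi
    simp only [Finset.mem_union, F₁, F₂, F₃, Finset.mem_filter, hi, true_and]
    rcases h1 with h1 | h1
    · rcases h3 with h3 | h3
      · exact Or.inl (Or.inr ⟨hswap h1, h3⟩)
      · exact Or.inl (Or.inl ⟨h1, h3⟩)
    · rcases h2 with h2 | h2
      · exact Or.inl (Or.inr ⟨h2, hswap h1⟩)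
      · exact Or.inr ⟨h1, h2⟩
  have hcard := (Finset.card_le_card hsub).trans ((Finset.card_union_le _ _).trans
    (Nat.add_le_add_right (Finset.card_union_le _ _) _))
  have hcases : Nat.card H.edgeSet ≤ F₁.card ∨ Nat.card H.edgeSet ≤ F₂.card ∨
      Nat.card H.edgeSet ≤ F₃.card := by omega
  have hyx := notMem_ballOn_comm hxy
  have hzx := notMem_ballOn_comm hxz
  have hzy := notMem_ballOn_comm hyz
  rcases hcases with h | h | h
  · exact hT.not_subdivisionFree_of_hub hH hJ hρ hj hx hy hz hxy hxz hyz hS' t1 t2 t3 t4 h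
      (fun i hi => hFM i (Finset.mem_filter.1 hi).1) (fun i hi => (Finset.mem_filter.1 hi).2.1)
      fun i hi => (Finset.mem_filter.1 hi).2.2
  · exact hT.not_subdivisionFree_of_hub hH hJ hρ hj hy hx hz hyx hyz hxz hS'' r1 r2 r3 r4 h
      (fun i hi => hFM i (Finset.mem_filter.1 hi).1) (fun i hi => (Finset.mem_filter.1 hi).2.1)
      fun i hi => (Finset.mem_filter.1 hi).2.2
  · exact hT.not_subdivisionFree_of_hub hH hJ hρ hj hx hz hy hxz hxy hzy hS s1 s2 s3 s4 h
      (fun i hi => hFM i (Finset.mem_filter.1 hi).1) (fun i hi => (Finset.mem_filter.1 hi).2.1)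
      fun i hi => (Finset.mem_filter.1 hi).2.2

/-- Here `x`, `y`, `z` themselves are the branch vertices. The line `U i` and the parents `q i x`,
`q i y`, `q i z` form `T i`, and any pair can be joined inside `T i` by omitting the parent of the
third vertex. -/
theorem Tower.not_subdivisionFree_of_not_touching {A B W : Type*} {H : Graph A B}
    (hH : IsFatTriangle H) [Finite W] {J : SimpleGraph W} (hJ : IsSubdivision H J)
    (hT : G.Tower M C U Q q) {ρ τ : ℕ} (hρ : Nat.card W + 4 ≤ ρ)
    (hball : ∀ x, G.ColOn (G.ballOn x ρ) τ) {x y z : V} (hx : x ∈ C M) (hy : y ∈ C M)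
    (hz : z ∈ C M) (hxy : y ∉ G.ballOn x ρ) (hxz : z ∉ G.ballOn x ρ) (hyz : z ∉ G.ballOn y ρ)
    {F : Finset ℕ} (hF : τ * (τ * τ) * (Nat.card H.edgeSet + 1) < F.card) (hFM : ∀ i ∈ F, i < M)
    (htouch : ∀ j ∈ F, ∀ i ∈ F, j < i → ∀ y ∈ C M, ¬ G.Touches (q j y) (U i)) :
    ¬ SubdivisionFree J G := by
  classical
  choose f hf hfp using hball
  have hpar : ∀ i ∈ F, ∀ t ∈ C M, q i t ∈ Q i ∧ G.Adj t (q i t) := fun i hi t ht =>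
    hT.parent_top (hFM i hi) ht
  have hqball : ∀ i ∈ F, ∀ t ∈ C M, q i t ∈ G.ballOn t ρ := fun i hi t ht =>
    ballOn_mono t (by omega) (mem_ballOn_one (hpar i hi t ht).2)
  -- Keep only indices whose three parents have the same colours in `τ`-colourings of the balls
  -- around `x`, `y` and `z`: parents of one vertex with equal colours are not adjacent.
  obtain ⟨k, -, hk⟩ := Finset.exists_lt_card_fiber_of_mul_lt_card_of_maps_to (s := F)
    (t := Finset.range τ ×ˢ (Finset.range τ ×ˢ Finset.range τ))
    (f := fun i => (f x (q i x), f y (q i y), f z (q i z))) (n := Nat.card H.edgeSet + 1)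
    (fun i hi => by
      simp only [Finset.mem_product, Finset.mem_range]
      exact ⟨hf x _ (hqball i hi x hx), hf y _ (hqball i hi y hy), hf z _ (hqball i hi z hz)⟩)
    (by simpa using hF)
  set F' := F.filter fun i => (f x (q i x), f y (q i y), f z (q i z)) = k with hF'
  set X : Set V := {x, y, z} with hX
  have hXC : ∀ t ∈ X, t ∈ C M := by
    rintro t (rfl | rfl | rfl) <;> assumption
  have hXfar : ∀ s ∈ X, ∀ t ∈ X, s ≠ t → t ∉ G.ballOn s ρ := by
    rintro s (rfl | rfl | rfl) t (rfl | rfl | rfl) hst <;>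
      first
      | exact absurd rfl hst
      | assumption
      | (apply notMem_ballOn_comm; assumption)
  have hF'F : ∀ i ∈ F', i ∈ F := fun i hi => (Finset.mem_filter.1 hi).1
  have hcol : ∀ i ∈ F', ∀ j ∈ F', ∀ t ∈ X, f t (q i t) = f t (q j t) := by
    intro i hi j hj t ht
    have h := (Finset.mem_filter.1 hi).2.trans (Finset.mem_filter.1 hj).2.symm
    simp only [Prod.mk.injEq] at h
    rcases ht with rfl | rfl | rfl
    · exact h.1
    · exact h.2.1
    · exact h.2.2
  set T : ℕ → Set V := fun i => U i ∪ {v | ∃ t ∈ X, v = q i t} with hTdef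
  have hlt : ∀ i ∈ F', ∀ j ∈ F', i < j → G.Anticomplete (T i) (T j) := by
    intro i hi j hj hij
    have hiM := hFM i (hF'F i hi)
    have hjM := hFM j (hF'F j hj)
    have hLj := hT.layer j hjM
    have hQj : ∀ t ∈ X, q j t ∈ C j := fun t ht =>
      hLj.subset_Q (hpar j (hF'F j hj) t (hXC t ht)).1
    have hQi : ∀ t ∈ X, q i t ∉ C j := fun t ht h =>
      Set.disjoint_left.1 (hT.Q_disjoint hij hjM.le) (hpar i (hF'F i hi) t (hXC t ht)).1 h
    rintro v (hv | ⟨s, hs, rfl⟩) w (hw | ⟨t, ht, rfl⟩)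
    · exact hT.U_anti_U hiM hjM hij.ne v hv w hw
    · exact hT.U_anti hij hjM.le v hv _ (hQj t ht)
    · refine ⟨fun h => hQi s hs (h ▸ hLj.subset_U hw), fun h => ?_⟩
      exact htouch i (hF'F i hi) j (hF'F j hj) hij s (hXC s hs) ⟨w, hw, h⟩
    · refine ⟨fun h => hQi s hs (h ▸ hQj t ht), fun h => ?_⟩
      by_cases hst : s = t
      · subst hst
        exact hfp s _ (hqball i (hF'F i hi) s (hXC s hs)) _ (hqball j (hF'F j hj) s (hXC s hs)) h
          (hcol i hi j hj s hs)
      · exact notMem_ballOn_of_adj (m := 1) (by omega) (hXfar s hs t ht hst)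
          (hpar i (hF'F i hi) s (hXC s hs)).2 (hpar j (hF'F j hj) t (hXC t ht)).2
          (mem_ballOn_one h)
  have hTT : ∀ i ∈ F', ∀ j ∈ F', i ≠ j → G.Anticomplete (T i) (T j) := by
    intro i hi j hj hij
    rcases lt_or_gt_of_ne hij with h | h
    · exact hlt i hi j hj h
    · exact (hlt j hj i hi h).symm
  have hcon : ∀ i ∈ F', ∀ r ∈ X, ∀ s ∈ X, ∀ t ∈ X, t ≠ r → t ≠ s →
      ∃ Y ⊆ T i, G.IsConnector r s t Y := by
    intro i hi r hr s hs t ht htr hts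
    have hiM := hFM i (hF'F i hi)
    have hL := hT.layer i hiM
    have hp : ∀ t ∈ X, q i t ∈ Q i ∧ G.Adj t (q i t) := fun t ht =>
      hpar i (hF'F i hi) t (hXC t ht)
    have hn : ∀ t ∈ X, t ∉ insert (q i r) (insert (q i s) (U i)) := by
      intro t ht
      have hQ : ∀ v ∈ X, t ≠ q i v := by
        rintro v hv rfl
        exact Set.disjoint_left.1 (hT.Q_disjoint hiM le_rfl) (hp v hv).1 (hXC _ ht)
      rintro (h | h | h)
      · exact hQ r hr h
      · exact hQ s hs h
      · exact (hT.U_anti hiM le_rfl t h t (hXC t ht)).1 rfl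
    have hno : ∀ v ∈ X, t ≠ v → ¬ G.Adj t (q i v) := fun v hv hne =>
      not_adj_of_notMem_ballOn (n := ρ) (by omega) (hXfar v hv t ht hne.symm) (hp v hv).2
    refine ⟨insert (q i r) (insert (q i s) (U i)), ?_, ?_, ⟨q i r, by simp, (hp r hr).2⟩,
      ⟨q i s, by simp, (hp s hs).2⟩, ?_, hn r hr, hn s hs, hn t ht⟩
    · rintro v (rfl | rfl | hv)
      · exact Or.inr ⟨r, hr, rfl⟩
      · exact Or.inr ⟨s, hs, rfl⟩
      · exact Or.inl hv
    · exact (hL.conn.union_singleton (hL.touch _ (hp s hs).1)).union_singleton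
        ((hL.touch _ (hp r hr).1).mono (Set.subset_insert _ _))
    · rintro ⟨v, rfl | rfl | hv, hadj⟩
      · exact hno r hr htr hadj
      · exact hno s hs hts hadj
      · exact (hT.U_anti hiM le_rfl v hv t (hXC t ht)).2 hadj.symm
  have hxX : x ∈ X := by simp [hX]
  have hyX : y ∈ X := by simp [hX]
  have hzX : z ∈ X := by simp [hX]
  have hne : ∀ {s t : V}, t ∉ G.ballOn s ρ → s ≠ t := by
    rintro s t h rfl
    exact h (mem_ballOn_self _ _)
  have hsmall : ∀ {s t : V}, t ∉ G.ballOn s ρ → t ∉ G.ballOn s (Nat.card W) := fun h h' =>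
    h (ballOn_mono _ (by omega) h')
  -- The fibre has at least `Nat.card H.edgeSet + 2` indices: two for the parallel edges, and enough
  -- others to reserve one for every edge of `H`.
  obtain ⟨k₁, hk₁, k₂, hk₂, hkk⟩ := Finset.one_lt_card.1 (show 1 < F'.card by
    have : 0 < Nat.card H.edgeSet := by
      obtain ⟨hfin, -, -, -, -, -, -, -, f₁, -⟩ := hH.exists_shape
      exact Nat.card_pos_iff.2 ⟨⟨f₁⟩, hfin⟩
    omega)
  obtain ⟨Y, hY, hYc⟩ := hcon k₁ hk₁ x hxX z hzX y hyX (hne hxy).symm (hne hyz)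
  obtain ⟨Z, hZ, hZc⟩ := hcon k₂ hk₂ x hxX z hzX y hyX (hne hxy).symm (hne hyz)
  have hF'' : ∀ i ∈ (F'.erase k₁).erase k₂, i ∈ F' ∧ k₁ ≠ i ∧ k₂ ≠ i := fun i hi => by
    simp only [Finset.mem_erase] at hi
    exact ⟨hi.2.2, hi.2.1.symm, hi.1.symm⟩
  refine not_subdivisionFree_of_connectors hH hJ (hsmall hxy) (hsmall hxz) (hsmall hyz) hYc hZc
    ((hTT k₁ hk₁ k₂ hk₂ hkk).mono hY hZ) (F := (F'.erase k₁).erase k₂) (T := T) ?_ ?_ ?_ ?_ ?_ ?_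
  · rw [Finset.card_erase_of_mem (by simp [hkk.symm, hk₂]), Finset.card_erase_of_mem hk₁]
    omega
  · exact fun i hi => hcon i (hF'' i hi).1 x hxX y hyX z hzX (hne hxz).symm (hne hyz).symm
  · exact fun i hi => hcon i (hF'' i hi).1 z hzX y hyX x hxX (hne hxz) (hne hxy)
  · exact fun i hi => (hTT k₁ hk₁ i (hF'' i hi).1 (hF'' i hi).2.1).mono hY subset_rfl
  · exact fun i hi => (hTT k₂ hk₂ i (hF'' i hi).1 (hF'' i hi).2.2).mono hZ subset_rfl
  · exact fun i hi j hj hij => hTT i (hF'' i hi).1 j (hF'' j hj).1 hij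

theorem Tower.touches_iff (hT : G.Tower M C U Q q) {i j : ℕ} (hji : j < i) (hi : i < M) :
    (∀ y ∈ C M, G.Touches (q j y) (U i)) ∨ ∀ y ∈ C M, ¬ G.Touches (q j y) (U i) := by
  have h := hT.antitone (Nat.succ_le_of_lt hi) le_rfl
  exact (hT.uniform i hi j hji).imp (fun h' y hy => h' y (h hy)) fun h' y hy => h' y (h hy)

/-! ### Chromatic numbers and the main bound. -/

theorem colOn_of_localChromaticNumber_le {ρ τ : ℕ} (h : localChromaticNumber ρ G ≤ τ) (x : V) :
    G.ColOn (G.ballOn x ρ) τ := by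
  rw [colOn_iff_colorable, ← chromaticNumber_le_iff_colorable]
  exact (le_iSup (fun v : V => (G.induce (G.ballOn v ρ)).chromaticNumber) x).trans h

theorem chromaticNumber_le_of_colOn_univ {k : ℕ} (h : G.ColOn Set.univ k) :
    G.chromaticNumber ≤ k := by
  rw [chromaticNumber_le_iff_colorable]
  exact (colOn_iff_colorable.1 h).of_hom (G.induceUnivIso.symm.toHom)

end SimpleGraph

theorem IsFatTriangle.exists_chromaticNumber_bound {α : Type a} {β : Type b} {H : Graph α β}
    (hH : IsFatTriangle H) {W : Type w} [Finite W] {J : SimpleGraph W} (hJ : IsSubdivision H J)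
    (τ : ℕ) : ∃ c : ℕ, ∀ (V : Type u) [Finite V] (G : SimpleGraph V), SubdivisionFree J G →
      localChromaticNumber (2 * Nat.card W + 7) G ≤ (τ : ℕ∞) → G.chromaticNumber ≤ (c : ℕ∞) := by
  set E := Nat.card H.edgeSet
  -- `m` independent indices beat the pigeonhole over the `τ ^ 3` colour triples; `3 * E` related
  -- ones leave `E` lines with a common hub; height `m * (3 * E + 1)` forces one or the other.
  set m := τ * (τ * τ) * (E + 1) + 1 with hm
  set M := m * (3 * E + 1) with hM
  refine ⟨towerBound τ M (4 * τ), fun V _ G hfree hloc => ?_⟩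
  have hball := colOn_of_localChromaticNumber_le hloc
  by_contra hbig
  obtain ⟨C, U, Q, q, hT, hk⟩ := exists_tower
    (fun x => (hball x).mono (ballOn_mono x (by omega)) le_rfl) M (4 * τ) (S := Set.univ)
    fun h => hbig (chromaticNumber_le_of_colOn_univ h)
  have htri : ∀ j < M, G.HasTriple (C M) (q j) (2 * Nat.card W + 7) := fun j hj =>
    hasTriple_of_not_colOn (by omega) hball (fun y hy => (hT.parent_top hj hy).2) hk
  have hM0 : 0 < M := by positivity
  rcases exists_star_or_independent (fun j i => ∀ y ∈ C M, G.Touches (q j y) (U i)) (3 * E) m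
    (Finset.range M) (by simp [hM]) with ⟨j, hj, F, hFM, hF, h⟩ | ⟨F, hFM, hF, h⟩
  · exact hT.not_subdivisionFree_of_touching hH hJ (by omega) (Finset.mem_range.1 hj)
      (htri j (Finset.mem_range.1 hj)) hF
      (fun i hi => ⟨(h i hi).1, Finset.mem_range.1 (hFM hi)⟩) (fun i hi => (h i hi).2) hfree
  · obtain ⟨x, hx, y, hy, z, hz, hxy, hxz, hyz, -⟩ := htri 0 hM0
    exact hT.not_subdivisionFree_of_not_touching hH hJ (by omega) hball hx hy hz hxy hxz hyz
      (by rw [hF]; exact Nat.lt_succ_self _) (fun i hi => Finset.mem_range.1 (hFM hi))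
      (fun j hj i hi hji => (hT.touches_iff hji (Finset.mem_range.1 (hFM hi))).resolve_left
        (h j hj i hi hji)) hfree

theorem theorem1p14 {α : Type a} {β : Type b} (H : Graph α β)
    (hH : IsFatTriangle H) :
    Widespread.{u, w, a, b} H ∧
    ∀ (W : Type w) [Finite W] (J : SimpleGraph W), IsSubdivision H J →
      ∀ κ τ : ℕ, ∃ c : ℕ, ∀ (V : Type u) [Finite V] (G : SimpleGraph V),
        SubdivisionFree J G →
        localChromaticNumber (2 * Nat.card W + 7) G ≤ (τ : ℕ∞) →
        G.cliqueNum ≤ κ →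
        G.chromaticNumber ≤ (c : ℕ∞) := by
  constructor
  · intro W _ J hJ κ
    refine ⟨2 * Nat.card W + 7, fun C hC hfree => ?_⟩
    obtain ⟨τ, hτ⟩ := hC
    obtain ⟨c, hc⟩ := hH.exists_chromaticNumber_bound hJ τ
    exact ⟨c, fun V _ G hG => hc V G (hfree V G hG).1 (hτ V G hG)⟩
  · intro W _ J hJ κ τ
    obtain ⟨c, hc⟩ := hH.exists_chromaticNumber_bound hJ τ
    exact ⟨c, fun V _ G hG hloc _ => hc V G hG hloc⟩
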